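/- An Arveson system is a measurable family $\mathcal E=(\mathcal E_t)_{t\ge 0}$ of separable complex Hilbert spaces together with a measurable family of unitaries $V_{s,t}:\mathcal E_s\otimes\mathcal E_t\to\mathcal E_{s+t}$ ($s,t\ge 0$) satisfying $V_{r,s+t}\circ(1_{\mathcal E_r}\otimes V_{s,t})=V_{r+s,t}\circ(V_{r,s}\otimes 1_{\mathcal E_t})$ for all $r,s,t\ge 0$. A product subsystem of $\mathcal E$ is a family $\mathcal E'=(\mathcal E'_t)_{t\ge0}$ of closed subspaces $\mathcal E'_t\subseteq\mathcal E_t$ with $V_{s,t}(\mathcal E'_s\otimes\mathcal E'_t)=\mathcal E'_{s+t}$ for all $s,t\ge 0$. Ordered by inclusion, the product subsystems form a complete lattice whose meets are intersections; $\mathcal E'\vee\mathcal E''$ denotes the smallest product subsystem containing $\mathcal E'$ and $\mathcal E''$. A unit of $\mathcal E$ is a measurable non-zero section $u=(u_t)_{t\ge 0}$ through $\mathcal E$ with $u_{s+t}=V_{s,t}(u_s\otimes u_t)$ for all $s,t\ge 0$; it is unital if $\|u_t\|=1$ for all $t\ge0$. The tensor product $\mathcal E\otimes\mathcal F$ of two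 Arveson systems is the Arveson system with spaces $\mathcal E_t\otimes\mathcal F_t$ and the unitaries obtained from those of $\mathcal E$ and $\mathcal F$ by exchanging the two middle factors of $(\mathcal E_s\otimes\mathcal F_s)\otimes(\mathcal E_t\otimes\mathcal F_t)$. Corollary (amalgamation over all units). Let $\mathcal E$ and $\mathcal F$ be Arveson systems and denote by $\mathcal E^0$ and $\mathcal F^0$ the product subsystems of $\mathcal E$ and $\mathcal F$ generated by all units of $\mathcal E$ and of $\mathcal F$, respectively. Then, for every unital unit $u$ of $\mathcal E$ and every unital unit $v$ of $\mathcal F$, the product with amalgamation over all units $$(\mathcal E\otimes\mathcal F^0)\vee(\mathcal E^0\otimes\mathcal F)$$ and the spatial product $$\mathcal E\,{}_u\!\otimes_v\mathcal F:=(u\otimes\mathcal F)\vee(\mathcal E\otimes v)$$ coincide as product subsystems of $\mathcal E\otimes\mathcal F$, where $u\otimes\mathcal F=(\mathbb C u_t\otimes\mathcal F_t)_{t\ge0}$ and $\mathcal E\otimes v=(\mathcal E_t\otimes\mathbb C v_t)_{t\ge0}$. -/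

import Mathlib

open scoped NNReal TensorProduct

universe u v

noncomputable section

/-! ## The Hilbert space tensor product -/

/-- The tensor product of two Hilbert spaces: the completion of the algebraic tensor product with
respect to the inner product `⟪a ⊗ b, c ⊗ d⟫ = ⟪a, c⟫ * ⟪b, d⟫`. -/
abbrev HilbertTensor (H : Type u) (K : Type v) [NormedAddCommGroup H] [InnerProductSpace ℂ H]
    [NormedAddCommGroup K] [InnerProductSpace ℂ K] : Type (max u v) :=
  UniformSpace.Completion (H ⊗[ℂ] K)

namespace HilbertTensor

section basics

variable {H : Type*} {K : Type*} {H' : Type*} {K' : Type*} {L : Type*}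
  [NormedAddCommGroup H] [InnerProductSpace ℂ H] [NormedAddCommGroup K] [InnerProductSpace ℂ K]
  [NormedAddCommGroup H'] [InnerProductSpace ℂ H'] [NormedAddCommGroup K'] [InnerProductSpace ℂ K']
  [NormedAddCommGroup L] [InnerProductSpace ℂ L]

/-- Elementary tensors, as a continuous bilinear map. -/
def mkL (H : Type*) (K : Type*) [NormedAddCommGroup H] [InnerProductSpace ℂ H]
    [NormedAddCommGroup K] [InnerProductSpace ℂ K] : H →L[ℂ] K →L[ℂ] HilbertTensor H K :=
  (ContinuousLinearMap.compL ℂ K (H ⊗[ℂ] K) (HilbertTensor H K)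
    UniformSpace.Completion.toComplL).comp (TensorProduct.mkL ℂ H K)

/-- The elementary tensor `x ⊗ y` in the Hilbert space tensor product. -/
def tmul (x : H) (y : K) : HilbertTensor H K := ((x ⊗ₜ[ℂ] y : H ⊗[ℂ] K) : HilbertTensor H K)

theorem mkL_apply (x : H) (y : K) : mkL H K x y = tmul x y := rfl

theorem inner_tmul (a c : H) (b d : K) :
    inner ℂ (tmul a b) (tmul c d) = inner ℂ a c * inner ℂ b d := by
  simp [tmul, UniformSpace.Completion.inner_coe]

/-- A closed subspace that contains all the elementary tensors is everything. -/
theorem eq_top_of_tmul_mem (W : Submodule ℂ (HilbertTensor H K)) (hW : IsClosed (W : Set (HilbertTensor H K)))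
    (h : ∀ x y, tmul x y ∈ W) : W = ⊤ := by
  rw [eq_top_iff]
  intro z _
  refine UniformSpace.Completion.induction_on (p := fun z => z ∈ W) z hW fun a => ?_
  induction a using TensorProduct.induction_on with
  | zero => rw [UniformSpace.Completion.coe_zero]; exact W.zero_mem
  | tmul x y => exact h x y
  | add a b ha hb => rw [UniformSpace.Completion.coe_add]; exact W.add_mem ha hb

theorem clm_ext {f g : HilbertTensor H K →L[ℂ] L} (h : ∀ x y, f (tmul x y) = g (tmul x y)) :
    f = g := by
  have htop : LinearMap.ker (f - g).toLinearMap = ⊤ :=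
    eq_top_of_tmul_mem _ (ContinuousLinearMap.isClosed_ker _) fun x y => sub_eq_zero.2 (h x y)
  ext z
  have hz : z ∈ LinearMap.ker (f - g).toLinearMap := htop ▸ Submodule.mem_top
  exact sub_eq_zero.1 hz

/-- The continuous bilinear map `(x, y) ↦ V (x ⊗ y)`. -/
def bilin (V : HilbertTensor H K ≃ₗᵢ[ℂ] L) : H →L[ℂ] K →L[ℂ] L :=
  (ContinuousLinearMap.compL ℂ K (HilbertTensor H K) L
    (V.toContinuousLinearEquiv : HilbertTensor H K →L[ℂ] L)).comp (mkL H K)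

theorem bilin_apply (V : HilbertTensor H K ≃ₗᵢ[ℂ] L) (x : H) (y : K) :
    bilin V x y = V (tmul x y) := rfl

/-- The map induced on algebraic tensor products by two isometries, with values in the Hilbert
space tensor product. -/
def mapCoe (f : H →ₗᵢ[ℂ] H') (g : K →ₗᵢ[ℂ] K') : H ⊗[ℂ] K →ₗᵢ[ℂ] HilbertTensor H' K' :=
  UniformSpace.Completion.toComplₗᵢ.comp (TensorProduct.mapIsometry f g)

theorem mapCoe_tmul (f : H →ₗᵢ[ℂ] H') (g : K →ₗᵢ[ℂ] K') (x : H) (y : K) :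
    mapCoe f g (x ⊗ₜ y) = tmul (f x) (g y) := rfl

/-- A bilinear image of two closures lies in a closed subspace once it does so on the
subspaces. -/
theorem mem_of_mem_closure (β : H →L[ℂ] K →L[ℂ] L) (s : Set H) (t : Set K)
    (W : Submodule ℂ L) (hW : IsClosed (W : Set L)) (h : ∀ x ∈ s, ∀ y ∈ t, β x y ∈ W)
    {x : H} {y : K} (hx : x ∈ (Submodule.span ℂ s).topologicalClosure)
    (hy : y ∈ (Submodule.span ℂ t).topologicalClosure) : β x y ∈ W := by
  have key : ∀ y ∈ t, β x y ∈ W := by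
    intro y hy
    have : (Submodule.span ℂ s).topologicalClosure ≤ W.comap (β.flip y).toLinearMap := by
      refine Submodule.topologicalClosure_minimal _ ?_ (hW.preimage (β.flip y).continuous)
      exact Submodule.span_le.2 fun x hx => h x hx y hy
    exact this hx
  have : (Submodule.span ℂ t).topologicalClosure ≤ W.comap (β x).toLinearMap := by
    refine Submodule.topologicalClosure_minimal _ ?_ (hW.preimage (β x).continuous)
    exact Submodule.span_le.2 fun y hy => key y hy
  exact this hy

theorem denseRange_mapCoe (f : H →ₗᵢ[ℂ] H') (g : K →ₗᵢ[ℂ] K') (hf : DenseRange f)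
    (hg : DenseRange g) : DenseRange (mapCoe f g) := by
  set W := (LinearMap.range (mapCoe f g).toLinearMap).topologicalClosure with hWdef
  have hcl : IsClosed (W : Set (HilbertTensor H' K')) := Submodule.isClosed_topologicalClosure _
  have hW : W = ⊤ := by
    refine eq_top_of_tmul_mem W hcl fun x y => ?_
    refine mem_of_mem_closure (mkL H' K') (Set.range f) (Set.range g) W hcl ?_
      (x := x) (y := y) ?_ ?_
    · rintro _ ⟨a, rfl⟩ _ ⟨b, rfl⟩
      exact subset_closure ⟨a ⊗ₜ b, rfl⟩
    · exact closure_mono Submodule.subset_span (hf x)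
    · exact closure_mono Submodule.subset_span (hg y)
  intro z
  have : z ∈ W := hW ▸ Submodule.mem_top
  exact this

/-- The exchange `(a ⊗ b) ⊗ (c ⊗ d) ↦ (a ⊗ c) ⊗ (b ⊗ d)` of the two middle factors, on algebraic
tensor products. -/
def algExchange (H : Type*) (K : Type*) (H' : Type*) (K' : Type*)
    [NormedAddCommGroup H] [InnerProductSpace ℂ H] [NormedAddCommGroup K] [InnerProductSpace ℂ K]
    [NormedAddCommGroup H'] [InnerProductSpace ℂ H']
    [NormedAddCommGroup K'] [InnerProductSpace ℂ K'] :
    (H ⊗[ℂ] K) ⊗[ℂ] (H' ⊗[ℂ] K') ≃ₗᵢ[ℂ] (H ⊗[ℂ] H') ⊗[ℂ] (K ⊗[ℂ] K') :=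
  (TensorProduct.assocIsometry ℂ H K (H' ⊗[ℂ] K')).trans <|
    (TensorProduct.congrIsometry (LinearIsometryEquiv.refl ℂ H)
      ((TensorProduct.assocIsometry ℂ K H' K').symm.trans <|
        (TensorProduct.congrIsometry (TensorProduct.commIsometry ℂ K H')
          (LinearIsometryEquiv.refl ℂ K')).trans <|
        TensorProduct.assocIsometry ℂ H' K K')).trans <|
    (TensorProduct.assocIsometry ℂ H H' (K ⊗[ℂ] K')).symm

theorem algExchange_tmul (a : H) (b : K) (c : H') (d : K') :
    algExchange H K H' K' ((a ⊗ₜ b) ⊗ₜ (c ⊗ₜ d)) = (a ⊗ₜ c) ⊗ₜ (b ⊗ₜ d) := rfl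

/-- The canonical unitary `(H ⊗ K) ⊗ (H' ⊗ K') ≃ L ⊗ L'` obtained from the exchange of the two
middle factors and unitaries `H ⊗ H' ≃ L`, `K ⊗ K' ≃ L'`. -/
def exchange {L' : Type*} [NormedAddCommGroup L'] [InnerProductSpace ℂ L']
    (V : HilbertTensor H H' ≃ₗᵢ[ℂ] L) (W : HilbertTensor K K' ≃ₗᵢ[ℂ] L') :
    HilbertTensor (HilbertTensor H K) (HilbertTensor H' K') ≃ₗᵢ[ℂ] HilbertTensor L L' :=
  LinearEquiv.extendOfIsometry
    (algExchange H K H' K').toLinearEquiv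
    (mapCoe (UniformSpace.Completion.toComplₗᵢ (𝕜 := ℂ) (E := H ⊗[ℂ] K))
      (UniformSpace.Completion.toComplₗᵢ (𝕜 := ℂ) (E := H' ⊗[ℂ] K'))).toLinearMap
    (mapCoe (V.toLinearIsometry.comp UniformSpace.Completion.toComplₗᵢ)
      (W.toLinearIsometry.comp UniformSpace.Completion.toComplₗᵢ)).toLinearMap
    (denseRange_mapCoe _ _ UniformSpace.Completion.denseRange_coe
      UniformSpace.Completion.denseRange_coe)
    (denseRange_mapCoe _ _
      (V.surjective.denseRange.comp UniformSpace.Completion.denseRange_coe V.continuous)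
      (W.surjective.denseRange.comp UniformSpace.Completion.denseRange_coe W.continuous))
    (by
      intro x
      rw [LinearIsometry.coe_toLinearMap, LinearIsometry.coe_toLinearMap,
        LinearIsometry.norm_map, LinearIsometry.norm_map]
      exact (algExchange H K H' K').norm_map x)

theorem exchange_tmul {L' : Type*} [NormedAddCommGroup L'] [InnerProductSpace ℂ L']
    (V : HilbertTensor H H' ≃ₗᵢ[ℂ] L) (W : HilbertTensor K K' ≃ₗᵢ[ℂ] L')
    (a : H) (b : K) (c : H') (d : K') :
    exchange V W (tmul (tmul a b) (tmul c d)) = tmul (V (tmul a c)) (W (tmul b d)) := by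
  exact LinearEquiv.extendOfIsometry_eq (algExchange H K H' K').toLinearEquiv
    _ _ _ _ _ ((a ⊗ₜ b) ⊗ₜ (c ⊗ₜ d))

/-- For closed subspaces `A ⊆ H` and `B ⊆ K`, the closed subspace `A ⊗ B` of `H ⊗ K`. -/
def sub (A : Submodule ℂ H) (B : Submodule ℂ K) : Submodule ℂ (HilbertTensor H K) :=
  (Submodule.span ℂ (Set.image2 tmul (A : Set H) (B : Set K))).topologicalClosure

theorem isClosed_sub (A : Submodule ℂ H) (B : Submodule ℂ K) :
    IsClosed (sub A B : Set (HilbertTensor H K)) := Submodule.isClosed_topologicalClosure _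

theorem tmul_mem_sub {A : Submodule ℂ H} {B : Submodule ℂ K} {x : H} {y : K} (hx : x ∈ A)
    (hy : y ∈ B) : tmul x y ∈ sub A B :=
  Submodule.le_topologicalClosure _ (Submodule.subset_span ⟨x, hx, y, hy, rfl⟩)

theorem sub_le {A : Submodule ℂ H} {B : Submodule ℂ K} {W : Submodule ℂ (HilbertTensor H K)}
    (hW : IsClosed (W : Set (HilbertTensor H K))) (h : ∀ x ∈ A, ∀ y ∈ B, tmul x y ∈ W) :
    sub A B ≤ W := by
  refine Submodule.topologicalClosure_minimal _ (Submodule.span_le.2 ?_) hW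
  rintro _ ⟨x, hx, y, hy, rfl⟩
  exact h x hx y hy

theorem sub_mono {A A' : Submodule ℂ H} {B B' : Submodule ℂ K} (hA : A ≤ A') (hB : B ≤ B') :
    sub A B ≤ sub A' B' :=
  sub_le (isClosed_sub _ _) fun _ hx _ hy => tmul_mem_sub (hA hx) (hB hy)

theorem adjoint_left_mem [CompleteSpace H] {A : Submodule ℂ H} (hA : IsClosed (A : Set H))
    {B : Submodule ℂ K} {z : HilbertTensor H K} (hz : z ∈ sub A B) (y : K) :
    ContinuousLinearMap.adjoint ((mkL H K).flip y) z ∈ A := by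
  have : sub A B ≤ A.comap (ContinuousLinearMap.adjoint ((mkL H K).flip y)).toLinearMap := by
    refine sub_le (hA.preimage (ContinuousLinearMap.continuous _)) fun a ha b _ => ?_
    have : ContinuousLinearMap.adjoint ((mkL H K).flip y) (tmul a b) = inner ℂ y b • a := by
      refine ext_inner_left ℂ fun w => ?_
      rw [ContinuousLinearMap.adjoint_inner_right, ContinuousLinearMap.flip_apply, mkL_apply,
        inner_tmul, inner_smul_right, mul_comm]
    change ContinuousLinearMap.adjoint ((mkL H K).flip y) (tmul a b) ∈ A
    rw [this]
    exact A.smul_mem _ ha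
  exact this hz

theorem adjoint_right_mem [CompleteSpace K] {A : Submodule ℂ H}
    {B : Submodule ℂ K} (hB : IsClosed (B : Set K)) {z : HilbertTensor H K} (hz : z ∈ sub A B)
    (x : H) : ContinuousLinearMap.adjoint (mkL H K x) z ∈ B := by
  have : sub A B ≤ B.comap (ContinuousLinearMap.adjoint (mkL H K x)).toLinearMap := by
    refine sub_le (hB.preimage (ContinuousLinearMap.continuous _)) fun a _ b hb => ?_
    have : ContinuousLinearMap.adjoint (mkL H K x) (tmul a b) = inner ℂ x a • b := by
      refine ext_inner_left ℂ fun w => ?_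
      rw [ContinuousLinearMap.adjoint_inner_right, mkL_apply, inner_tmul, inner_smul_right]
    change ContinuousLinearMap.adjoint (mkL H K x) (tmul a b) ∈ B
    rw [this]
    exact B.smul_mem _ hb
  exact this hz

/-- A vector all of whose slices lie in `A` and `B` lies in `A ⊗ B`. -/
theorem mem_sub_of_slices [CompleteSpace H] [CompleteSpace K] {A : Submodule ℂ H}
    (hA : IsClosed (A : Set H)) {B : Submodule ℂ K} (hB : IsClosed (B : Set K))
    {z : HilbertTensor H K}
    (h₁ : ∀ y, ContinuousLinearMap.adjoint ((mkL H K).flip y) z ∈ A)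
    (h₂ : ∀ x, ContinuousLinearMap.adjoint (mkL H K x) z ∈ B) : z ∈ sub A B := by
  have : CompleteSpace (sub A B) := (isClosed_sub A B).completeSpace_coe
  have : CompleteSpace A := hA.completeSpace_coe
  have : CompleteSpace B := hB.completeSpace_coe
  set p : HilbertTensor H K := (sub A B).starProjection z with hp
  have hpmem : p ∈ sub A B := Submodule.starProjection_apply_mem _ _
  have horth : z - p ∈ (sub A B)ᗮ := Submodule.sub_starProjection_mem_orthogonal _
  have g₁ : ∀ y, ContinuousLinearMap.adjoint ((mkL H K).flip y) (z - p) ∈ A := fun y => by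
    rw [map_sub]; exact A.sub_mem (h₁ y) (adjoint_left_mem hA hpmem y)
  have g₂ : ∀ x, ContinuousLinearMap.adjoint (mkL H K x) (z - p) ∈ B := fun x => by
    rw [map_sub]; exact B.sub_mem (h₂ x) (adjoint_right_mem hB hpmem x)
  have hzero : ∀ x y, inner ℂ (z - p) (tmul x y) = 0 := by
    intro x y
    have e₁ : tmul x y = tmul (A.starProjection x) (B.starProjection y)
        + (mkL H K).flip (B.starProjection y) (x - A.starProjection x)
        + mkL H K x (y - B.starProjection y) := by
      simp only [map_sub, ContinuousLinearMap.flip_apply, ← mkL_apply]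
      abel
    rw [e₁, inner_add_right, inner_add_right, ← ContinuousLinearMap.adjoint_inner_left,
      ← ContinuousLinearMap.adjoint_inner_left,
      Submodule.inner_right_of_mem_orthogonal (g₁ _) (Submodule.sub_starProjection_mem_orthogonal _),
      Submodule.inner_right_of_mem_orthogonal (g₂ _) (Submodule.sub_starProjection_mem_orthogonal _),
      Submodule.inner_left_of_mem_orthogonal (tmul_mem_sub
        (Submodule.starProjection_apply_mem _ _) (Submodule.starProjection_apply_mem _ _)) horth]
    simp
  have htop : LinearMap.ker (innerSL ℂ (z - p)).toLinearMap = ⊤ :=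
    eq_top_of_tmul_mem _ (ContinuousLinearMap.isClosed_ker _) fun x y => hzero x y
  have hmem : z - p ∈ LinearMap.ker (innerSL ℂ (z - p)).toLinearMap := htop ▸ Submodule.mem_top
  have h0 : inner ℂ (z - p) (z - p) = 0 := hmem
  rw [inner_self_eq_zero, sub_eq_zero] at h0
  rw [h0]; exact hpmem

/-- Tensor products of closed subspaces commute with intersections. -/
theorem mem_sub_iInf [CompleteSpace H] [CompleteSpace K] {ι : Sort*} {A : ι → Submodule ℂ H}
    (hA : ∀ i, IsClosed (A i : Set H)) {B : ι → Submodule ℂ K} (hB : ∀ i, IsClosed (B i : Set K))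
    {z : HilbertTensor H K} (h : ∀ i, z ∈ sub (A i) (B i)) : z ∈ sub (⨅ i, A i) (⨅ i, B i) := by
  refine mem_sub_of_slices ?_ ?_ ?_ ?_
  · simpa only [Submodule.coe_iInf] using isClosed_iInter hA
  · simpa only [Submodule.coe_iInf] using isClosed_iInter hB
  · exact fun y => (Submodule.mem_iInf _).2 fun i => adjoint_left_mem (hA i) (h i) y
  · exact fun x => (Submodule.mem_iInf _).2 fun i => adjoint_right_mem (hB i) (h i) x

theorem sub_top_top : sub (⊤ : Submodule ℂ H) (⊤ : Submodule ℂ K) = ⊤ :=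
  eq_top_of_tmul_mem _ (isClosed_sub _ _) fun _ _ => tmul_mem_sub trivial trivial

end basics

end HilbertTensor

infixl:100 " ⊗ₕ " => HilbertTensor.tmul

/-- The identification of `X i` with `X j` for `i = j`. -/
def castIso {ι : Type*} (X : ι → Type*) [∀ i, NormedAddCommGroup (X i)]
    [∀ i, InnerProductSpace ℂ (X i)] {i j : ι} (h : i = j) : X i ≃ₗᵢ[ℂ] X j := by
  subst h
  exact LinearIsometryEquiv.refl ℂ (X i)

theorem castIso_tmul {ι : Type*} (X : ι → Type*) (Y : ι → Type*) [∀ i, NormedAddCommGroup (X i)]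
    [∀ i, InnerProductSpace ℂ (X i)] [∀ i, NormedAddCommGroup (Y i)]
    [∀ i, InnerProductSpace ℂ (Y i)] {i j : ι} (h : i = j) (x : X i) (y : Y i) :
    castIso (fun i => HilbertTensor (X i) (Y i)) h (x ⊗ₕ y) = castIso X h x ⊗ₕ castIso Y h y := by
  subst h
  rfl

/-! ## Arveson systems -/

/-- An Arveson system: a measurable family `(E_t)_{t ≥ 0}` of separable Hilbert spaces together
with a measurable family of unitaries `V_{s,t} : E_s ⊗ E_t → E_{s+t}` satisfying the associativity
law `V_{r,s+t} ∘ (1 ⊗ V_{s,t}) = V_{r+s,t} ∘ (V_{r,s} ⊗ 1)`.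

The measurable structure is given by a fundamental sequence of measurable sections, which is total
at every time (so each `E_t` is separable) and has measurable mutual inner products; a section is
measurable if its inner products with the members of the sequence are measurable. -/
structure ArvesonSystem where
  /-- The Hilbert spaces `E_t`. -/
  space : ℝ≥0 → Type u
  [normedAddCommGroup : ∀ t, NormedAddCommGroup (space t)]
  [innerProductSpace : ∀ t, InnerProductSpace ℂ (space t)]
  [completeSpace : ∀ t, CompleteSpace (space t)]
  /-- The unitaries `V_{s,t}`. -/
  V : ∀ s t, HilbertTensor (space s) (space t) ≃ₗᵢ[ℂ] space (s + t)
  assoc : ∀ (r s t : ℝ≥0) (x : space r) (y : space s) (z : space t),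
    V r (s + t) (x ⊗ₕ V s t (y ⊗ₕ z)) =
      castIso space (add_assoc r s t) (V (r + s) t (V r s (x ⊗ₕ y) ⊗ₕ z))
  /-- The fundamental sequence of measurable sections. -/
  frame : ℕ → ∀ t, space t
  total_frame : ∀ t,
    (Submodule.span ℂ (Set.range fun n => frame n t)).topologicalClosure = ⊤
  measurable_frame : ∀ n m, Measurable fun t => inner ℂ (frame n t) (frame m t)
  measurable_V : ∀ n m k, Measurable fun p : ℝ≥0 × ℝ≥0 =>
    inner ℂ (frame k (p.1 + p.2)) (V p.1 p.2 (frame n p.1 ⊗ₕ frame m p.2))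

attribute [instance] ArvesonSystem.normedAddCommGroup ArvesonSystem.innerProductSpace
  ArvesonSystem.completeSpace

namespace ArvesonSystem

/-- A section through `E` is measurable if all its inner products with the fundamental sections
are. -/
def MeasurableSection (E : ArvesonSystem.{u}) (x : ∀ t, E.space t) : Prop :=
  ∀ n, Measurable fun t => inner ℂ (E.frame n t) (x t)

/-- A unit of an Arveson system: a measurable non-zero section `u` with
`u_{s+t} = u_s ⊗ u_t`. -/
structure UnitSection (E : ArvesonSystem.{u}) where
  /-- The underlying section. -/
  toFun : ∀ t, E.space t
  measurable : E.MeasurableSection toFun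
  ne_zero : toFun ≠ 0
  mul : ∀ s t, toFun (s + t) = E.V s t (toFun s ⊗ₕ toFun t)

/-- A unit is unital if it consists of unit vectors. -/
def UnitSection.IsUnital {E : ArvesonSystem.{u}} (w : E.UnitSection) : Prop :=
  ∀ t, ‖w.toFun t‖ = 1

theorem V_mem_of_tmul_mem (E : ArvesonSystem.{u}) {s t : ℝ≥0} {A : Submodule ℂ (E.space s)}
    {B : Submodule ℂ (E.space t)} {W : Submodule ℂ (E.space (s + t))}
    (hW : IsClosed (W : Set (E.space (s + t))))
    (h : ∀ x ∈ A, ∀ y ∈ B, E.V s t (x ⊗ₕ y) ∈ W) :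
    (HilbertTensor.sub A B).map (E.V s t).toLinearEquiv.toLinearMap ≤ W :=
  Submodule.map_le_iff_le_comap.2
    (HilbertTensor.sub_le (hW.preimage (E.V s t).continuous) h)

/-- The tensor product `E ⊗ F` of Arveson systems, with spaces `E_t ⊗ F_t` and
`(a ⊗ b)(c ⊗ d) = ac ⊗ bd`. -/
def tensor (E : ArvesonSystem.{u}) (F : ArvesonSystem.{v}) : ArvesonSystem.{max u v} where
  space t := HilbertTensor (E.space t) (F.space t)
  V s t := HilbertTensor.exchange (E.V s t) (F.V s t)
  assoc r s t x y z := by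
    have h₀ : ∀ a b c d e f, _ := fun (a : E.space r) (b : F.space r) (c : E.space s)
        (d : F.space s) (e : E.space t) (f : F.space t) =>
      show HilbertTensor.exchange (E.V r (s + t)) (F.V r (s + t)) ((a ⊗ₕ b) ⊗ₕ
          HilbertTensor.exchange (E.V s t) (F.V s t) ((c ⊗ₕ d) ⊗ₕ (e ⊗ₕ f))) =
        castIso (fun t => HilbertTensor (E.space t) (F.space t)) (add_assoc r s t)
          (HilbertTensor.exchange (E.V (r + s) t) (F.V (r + s) t)
            (HilbertTensor.exchange (E.V r s) (F.V r s) ((a ⊗ₕ b) ⊗ₕ (c ⊗ₕ d)) ⊗ₕ (e ⊗ₕ f)))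
      by simp only [HilbertTensor.exchange_tmul, castIso_tmul, E.assoc, F.assoc]
    let M := fun s t => HilbertTensor.bilin (HilbertTensor.exchange (E.V s t) (F.V s t))
    let C : HilbertTensor (E.space (r + s + t)) (F.space (r + s + t)) →L[ℂ]
        HilbertTensor (E.space (r + (s + t))) (F.space (r + (s + t))) :=
      ((castIso (fun t => HilbertTensor (E.space t) (F.space t))
        (add_assoc r s t)).toContinuousLinearEquiv : _ →L[ℂ] _)
    have h₁ : ∀ a b c d z, M r (s + t) (a ⊗ₕ b) (M s t (c ⊗ₕ d) z) =
        C (M (r + s) t (M r s (a ⊗ₕ b) (c ⊗ₕ d)) z) := fun a b c d =>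
      DFunLike.congr_fun (f := (M r (s + t) (a ⊗ₕ b)).comp (M s t (c ⊗ₕ d)))
        (g := C.comp (M (r + s) t (M r s (a ⊗ₕ b) (c ⊗ₕ d))))
        (HilbertTensor.clm_ext fun e f => h₀ a b c d e f)
    have h₂ : ∀ a b z y, M r (s + t) (a ⊗ₕ b) (M s t y z) =
        C (M (r + s) t (M r s (a ⊗ₕ b) y) z) := fun a b z =>
      DFunLike.congr_fun (f := (M r (s + t) (a ⊗ₕ b)).comp ((M s t).flip z))
        (g := C.comp (((M (r + s) t).flip z).comp (M r s (a ⊗ₕ b))))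
        (HilbertTensor.clm_ext fun c d => h₁ a b c d z)
    exact DFunLike.congr_fun (f := (M r (s + t)).flip (M s t y z))
        (g := C.comp (((M (r + s) t).flip z).comp ((M r s).flip y)))
        (HilbertTensor.clm_ext fun a b => h₂ a b z y) x
  frame n t := E.frame n.unpair.1 t ⊗ₕ F.frame n.unpair.2 t
  total_frame t := by
    refine HilbertTensor.eq_top_of_tmul_mem _ (Submodule.isClosed_topologicalClosure _) ?_
    intro x y
    refine HilbertTensor.mem_of_mem_closure (HilbertTensor.mkL _ _)
      (Set.range fun n => E.frame n t) (Set.range fun n => F.frame n t) _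
      (Submodule.isClosed_topologicalClosure _) ?_ (x := x) (y := y) ?_ ?_
    · rintro _ ⟨n, rfl⟩ _ ⟨m, rfl⟩
      refine Submodule.le_topologicalClosure _ (Submodule.subset_span ⟨Nat.pair n m, ?_⟩)
      simp only [Nat.unpair_pair]
      rfl
    · rw [E.total_frame]; trivial
    · rw [F.total_frame]; trivial
  measurable_frame n m := by
    simp only [HilbertTensor.inner_tmul]
    exact (E.measurable_frame _ _).mul (F.measurable_frame _ _)
  measurable_V n m k := by
    simp only [HilbertTensor.exchange_tmul, HilbertTensor.inner_tmul]
    exact (E.measurable_V _ _ _).mul (F.measurable_V _ _ _)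

/-! ## Product subsystems -/

/-- A product subsystem of `E`: a family of closed subspaces `S_t ⊆ E_t` such that `V_{s,t}`
restricts to a unitary `S_s ⊗ S_t → S_{s+t}`, that is, `V_{s,t}(S_s ⊗ S_t) = S_{s+t}`. (Such a
family is automatically measurable.) -/
@[ext]
structure Subsystem (E : ArvesonSystem.{u}) where
  /-- The closed subspaces `S_t`. -/
  carrier : ∀ t, Submodule ℂ (E.space t)
  isClosed : ∀ t, IsClosed (carrier t : Set (E.space t))
  map_V : ∀ s t, (HilbertTensor.sub (carrier s) (carrier t)).map
    (E.V s t).toLinearEquiv.toLinearMap = carrier (s + t)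

namespace Subsystem

variable {E : ArvesonSystem.{u}} {F : ArvesonSystem.{v}}

/-- Subsystems are ordered by inclusion of their spaces at all times. -/
instance : PartialOrder (Subsystem E) :=
  PartialOrder.lift Subsystem.carrier fun _ _ h => Subsystem.ext h

theorem le_def {S T : Subsystem E} : S ≤ T ↔ ∀ t, S.carrier t ≤ T.carrier t := Iff.rfl

/-- The intersection of a set of subsystems is a subsystem. -/
instance : InfSet (Subsystem E) where
  sInf 𝒮 :=
    { carrier := fun t => ⨅ S : 𝒮, S.1.carrier t
      isClosed := fun t => by
        simpa only [Submodule.coe_iInf] using isClosed_iInter fun S : 𝒮 => S.1.isClosed t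
      map_V := fun s t => by
        refine le_antisymm (le_iInf fun S => ?_) fun z hz => ?_
        · rw [← S.1.map_V s t]
          exact Submodule.map_mono (HilbertTensor.sub_mono (iInf_le _ S) (iInf_le _ S))
        · refine ⟨(E.V s t).symm z, HilbertTensor.mem_sub_iInf (fun S => S.1.isClosed s)
            (fun S => S.1.isClosed t) fun S => ?_, (E.V s t).apply_symm_apply z⟩
          have hz' := (Submodule.mem_iInf _).1 hz S
          rw [← S.1.map_V s t] at hz'
          obtain ⟨w, hw, rfl⟩ := hz'
          have : (E.V s t).symm (E.V s t w) ∈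
              HilbertTensor.sub (S.1.carrier s) (S.1.carrier t) := by
            rw [LinearIsometryEquiv.symm_apply_apply]; exact hw
          exact this }

theorem mem_sInf {𝒮 : Set (Subsystem E)} {t : ℝ≥0} {x : E.space t} :
    x ∈ (sInf 𝒮).carrier t ↔ ∀ S ∈ 𝒮, x ∈ S.carrier t :=
  (Submodule.mem_iInf _).trans Subtype.forall

/-- The product subsystems of `E` form a complete lattice. Meets are intersections; `S ⊔ T` is the
smallest subsystem containing both `S` and `T`. -/
instance : CompleteLattice (Subsystem E) :=
  completeLatticeOfInf (Subsystem E) fun _ =>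
    ⟨fun S hS _ _ hx => mem_sInf.1 hx S hS,
      fun _ hT t _ hx => mem_sInf.2 fun _ hS => hT hS t hx⟩

/-- The largest subsystem is `E` itself. -/
theorem carrier_top (t : ℝ≥0) : (⊤ : Subsystem E).carrier t = ⊤ := by
  rw [eq_top_iff]
  intro x _
  exact mem_sInf.2 fun S hS => absurd hS (Set.notMem_empty S)

/-- The smallest subsystem that contains the given sets `G_t ⊆ E_t`. -/
def generate (G : ∀ t, Set (E.space t)) : Subsystem E :=
  sInf {S | ∀ t, G t ⊆ S.carrier t}

/-- The tensor product of subsystems, as a subsystem of the tensor product. -/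
def tensor (S : Subsystem E) (T : Subsystem F) : Subsystem (E.tensor F) where
  carrier t := HilbertTensor.sub (S.carrier t) (T.carrier t)
  isClosed t := HilbertTensor.isClosed_sub _ _
  map_V s t := by
    refine le_antisymm ?_ ?_
    · refine (E.tensor F).V_mem_of_tmul_mem (HilbertTensor.isClosed_sub _ _) fun x hx y hy => ?_
      refine HilbertTensor.mem_of_mem_closure (HilbertTensor.bilin ((E.tensor F).V s t)) _ _ _
        (HilbertTensor.isClosed_sub _ _) ?_ hx hy
      rintro _ ⟨a, ha, b, hb, rfl⟩ _ ⟨c, hc, d, hd, rfl⟩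
      have h : HilbertTensor.bilin ((E.tensor F).V s t) (a ⊗ₕ b) (c ⊗ₕ d) =
          E.V s t (a ⊗ₕ c) ⊗ₕ F.V s t (b ⊗ₕ d) := HilbertTensor.exchange_tmul _ _ _ _ _ _
      rw [h]
      refine HilbertTensor.tmul_mem_sub ?_ ?_
      · rw [← S.map_V s t]
        exact ⟨_, HilbertTensor.tmul_mem_sub ha hc, rfl⟩
      · rw [← T.map_V s t]
        exact ⟨_, HilbertTensor.tmul_mem_sub hb hd, rfl⟩
    · have hcl : IsClosed (((HilbertTensor.sub
          (HilbertTensor.sub (S.carrier s) (T.carrier s))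
          (HilbertTensor.sub (S.carrier t) (T.carrier t))).map
            ((E.tensor F).V s t).toLinearEquiv.toLinearMap : Submodule ℂ _) :
            Set ((E.tensor F).space (s + t))) :=
        ((E.tensor F).V s t).toHomeomorph.isClosedMap _ (HilbertTensor.isClosed_sub _ _)
      refine HilbertTensor.sub_le hcl ?_
      intro p hp q hq
      rw [← S.map_V s t] at hp
      rw [← T.map_V s t] at hq
      obtain ⟨p, hp, rfl⟩ := hp
      obtain ⟨q, hq, rfl⟩ := hq
      refine HilbertTensor.mem_of_mem_closure
        ((HilbertTensor.mkL _ _).bilinearComp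
          ((E.V s t).toContinuousLinearEquiv : _ →L[ℂ] E.space (s + t))
          ((F.V s t).toContinuousLinearEquiv : _ →L[ℂ] F.space (s + t))) _ _ _ hcl ?_ hp hq
      rintro _ ⟨a, ha, c, hc, rfl⟩ _ ⟨b, hb, d, hd, rfl⟩
      exact ⟨(a ⊗ₕ b) ⊗ₕ (c ⊗ₕ d), HilbertTensor.tmul_mem_sub
        (HilbertTensor.tmul_mem_sub ha hb) (HilbertTensor.tmul_mem_sub hc hd),
        HilbertTensor.exchange_tmul _ _ _ _ _ _⟩

/-- The subsystem `(ℂ w_t)_t` spanned by a unit `w`. -/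
def line (w : E.UnitSection) : Subsystem E where
  carrier t := ℂ ∙ w.toFun t
  isClosed t := Submodule.closed_of_finiteDimensional _
  map_V s t := by
    refine le_antisymm (E.V_mem_of_tmul_mem (Submodule.closed_of_finiteDimensional _) ?_) ?_
    · intro x hx y hy
      obtain ⟨a, rfl⟩ := Submodule.mem_span_singleton.1 hx
      obtain ⟨b, rfl⟩ := Submodule.mem_span_singleton.1 hy
      refine Submodule.mem_span_singleton.2 ⟨a * b, ?_⟩
      rw [w.mul, ← HilbertTensor.mkL_apply, ← HilbertTensor.mkL_apply]
      simp [mul_smul, smul_comm a b]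
    · rw [Submodule.span_singleton_le_iff_mem, w.mul]
      exact ⟨_, HilbertTensor.tmul_mem_sub (Submodule.mem_span_singleton_self _)
        (Submodule.mem_span_singleton_self _), rfl⟩

end Subsystem

/-- The subsystem `E⁰` generated by all units of `E`. -/
def unitSubsystem (E : ArvesonSystem.{u}) : Subsystem E :=
  Subsystem.generate fun t => {x | ∃ w : E.UnitSection, x = w.toFun t}

/-- The spatial product of `E` and `F` with respect to units `w` of `E` and `w'` of `F`: the
subsystem `(w ⊗ F) ∨ (E ⊗ w')` of `E ⊗ F`. -/
def spatialProduct {E : ArvesonSystem.{u}} {F : ArvesonSystem.{v}} (w : E.UnitSection)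
    (w' : F.UnitSection) : Subsystem (E.tensor F) :=
  (Subsystem.line w).tensor ⊤ ⊔ (⊤ : Subsystem E).tensor (Subsystem.line w')

/-- The product of `E` and `F` with amalgamation over all units: the subsystem
`(E ⊗ F⁰) ∨ (E⁰ ⊗ F)` of `E ⊗ F`. -/
def amalgamatedProduct (E : ArvesonSystem.{u}) (F : ArvesonSystem.{v}) :
    Subsystem (E.tensor F) :=
  (⊤ : Subsystem E).tensor F.unitSubsystem ⊔ E.unitSubsystem.tensor ⊤

end ArvesonSystem

end

/-! One inclusion is formal: a unit spans a subsystem of the unit-generated one. For the other, let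
`S` be a subsystem containing `w ⊗ F` and `E ⊗ v`, with `w`, `v` unital. The point is that `S`
contains `w' ⊗ F` for every unit `w'` of `E` (`Pairing.unit_mem`). Products of units then give `E⁰ ⊗
F`, and exchanging the tensor factors gives `E ⊗ F⁰`.

Fix `x = w'_t ⊗ f` and let `D s` be the squared distance from `x` to the closed span of `S_s
G_{t-s}`. Degree zero is one-dimensional, so `D 0 = 0`, while `D t = 0` means `x ∈ S_t`. On a short
interval of length `ε`, approximate `f` by `q` in the closed span of `F_s v_ε F_r`. The part `w'_t ⊗
q` already has its middle factor in `S_ε`. In `w'_t ⊗ (f - q)`, replace `w'_ε` by its projection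
onto `ℂ w_ε`, which again puts the middle factor in `S_ε`. The squared error is at most `C ε ‖f -
q‖²`, so `D` is Lipschitz, and it has right slope zero because `q` can be taken arbitrarily close to
`f` as `ε → 0`. Hence `D t ≤ 0`.

Both analytic inputs come from separability, which forbids uncountable orthogonal families: units
with nonzero values have nonzero overlap, which decays multiplicatively and so differs from its
maximum by `O(ε)`; and the subspaces `F_s v_ε F_r` exhaust `F_t`. -/

theorem castIso_trans {ι : Type*} (X : ι → Type*) [∀ i, NormedAddCommGroup (X i)]
    [∀ i, InnerProductSpace ℂ (X i)] {i j k : ι} (h : i = j) (h' : j = k) (x : X i) :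
    castIso X h' (castIso X h x) = castIso X (h.trans h') x := by
  subst h h'
  rfl

/-- A family of nonzero pairwise orthogonal vectors in a separable space is countable. -/
theorem countable_of_pairwise_inner_eq_zero {H ι : Type*} [NormedAddCommGroup H]
    [InnerProductSpace ℂ H] [TopologicalSpace.SeparableSpace H] (y : ι → H) (h0 : ∀ i, y i ≠ 0)
    (h : Pairwise fun i j => inner ℂ (y i) (y j) = 0) : Countable ι := by
  set e : ι → H := fun i => ((‖y i‖⁻¹ : ℝ) : ℂ) • y i with he
  have he1 : ∀ i, ‖e i‖ = 1 := fun i => by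
    have := norm_ne_zero_iff.2 (h0 i)
    simp [he, norm_smul, this]
  refine Pairwise.countable_of_isOpen_disjoint (s := fun i => Metric.ball (e i) (1 / 2)) ?_
    (fun i => Metric.isOpen_ball) (fun i => Metric.nonempty_ball.2 (by norm_num))
  intro i j hij
  refine Metric.ball_disjoint_ball ?_
  have horth : inner ℂ (e i) (e j) = 0 := by
    rw [he, inner_smul_left, inner_smul_right, h hij, mul_zero, mul_zero]
  have := norm_sub_sq (𝕜 := ℂ) (e i) (e j)
  rw [horth, he1, he1] at this
  rw [dist_eq_norm]
  norm_num at this ⊢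
  nlinarith [norm_nonneg (e i - e j)]

/-! ### The graded product and its identity in degree zero. -/

namespace ArvesonSystem

variable {E : ArvesonSystem.{u}} {F : ArvesonSystem.{v}}

theorem separableSpace (E : ArvesonSystem.{u}) (t : ℝ≥0) :
    TopologicalSpace.SeparableSpace (E.space t) := by
  have h : TopologicalSpace.IsSeparable
      ((Submodule.span ℂ (Set.range fun n => E.frame n t)).topologicalClosure :
        Set (E.space t)) := by
    rw [Submodule.topologicalClosure_coe]
    exact ((Set.countable_range _).isSeparable.span).closure
  rw [E.total_frame t] at h
  exact TopologicalSpace.isSeparable_univ_iff.1 h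

/-- The product `E_s × E_r → E_t` for `s + r = t`, as a continuous bilinear map. -/
noncomputable def mul (E : ArvesonSystem.{u}) {s r t : ℝ≥0} (h : s + r = t) :
    E.space s →L[ℂ] E.space r →L[ℂ] E.space t := by
  subst h
  exact HilbertTensor.bilin (E.V s r)

theorem mul_rfl {s r : ℝ≥0} (x : E.space s) (y : E.space r) :
    E.mul rfl x y = E.V s r (x ⊗ₕ y) := rfl

theorem mul_eq_castIso {s r t : ℝ≥0} (h : s + r = t) (x : E.space s) (y : E.space r) :
    E.mul h x y = castIso E.space h (E.V s r (x ⊗ₕ y)) := by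
  subst h
  rfl

/-- Keeping all sums of times as hypotheses allows rebracketing by rewriting, with no transport
between fibres over equal times. -/
theorem mul_mul {r s t p p' q : ℝ≥0} (h₁ : r + s = p) (h₂ : p + t = q) (h₃ : s + t = p')
    (h₄ : r + p' = q) (x : E.space r) (y : E.space s) (z : E.space t) :
    E.mul h₂ (E.mul h₁ x y) z = E.mul h₄ x (E.mul h₃ y z) := by
  subst h₁ h₂ h₃
  rw [mul_eq_castIso h₄, mul_rfl, mul_rfl, mul_rfl, E.assoc, castIso_trans]
  rfl

theorem inner_mul {s r t : ℝ≥0} (h : s + r = t) (x x' : E.space s) (y y' : E.space r) :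
    inner ℂ (E.mul h x y) (E.mul h x' y') = inner ℂ x x' * inner ℂ y y' := by
  subst h
  rw [mul_rfl, mul_rfl, LinearIsometryEquiv.inner_map_map, HilbertTensor.inner_tmul]

theorem norm_mul {s r t : ℝ≥0} (h : s + r = t) (x : E.space s) (y : E.space r) :
    ‖E.mul h x y‖ = ‖x‖ * ‖y‖ := by
  have := inner_mul h x x y y
  simp only [inner_self_eq_norm_sq_to_K] at this
  norm_cast at this
  rw [← mul_pow] at this
  exact (sq_eq_sq₀ (norm_nonneg _) (by positivity)).1 this

/-- A closed subspace of `E_t` that contains all products is everything. -/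
theorem eq_top_of_mul_mem {s r t : ℝ≥0} (h : s + r = t) (W : Submodule ℂ (E.space t))
    (hW : IsClosed (W : Set (E.space t))) (hm : ∀ x y, E.mul h x y ∈ W) : W = ⊤ := by
  subst h
  have : W.comap (E.V s r).toLinearEquiv.toLinearMap = ⊤ :=
    HilbertTensor.eq_top_of_tmul_mem _ (hW.preimage (E.V s r).continuous) hm
  rw [eq_top_iff]
  intro z _
  have hz : (E.V s r).symm z ∈ W.comap (E.V s r).toLinearEquiv.toLinearMap :=
    this ▸ Submodule.mem_top
  simpa using hz

namespace UnitSection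

theorem mul_apply (w : E.UnitSection) {s r t : ℝ≥0} (h : s + r = t) :
    E.mul h (w.toFun s) (w.toFun r) = w.toFun t := by
  subst h
  exact (w.mul s r).symm

end UnitSection

theorem Subsystem.mul_mem (S : Subsystem E) {s r t : ℝ≥0} (h : s + r = t) {x : E.space s}
    {y : E.space r} (hx : x ∈ S.carrier s) (hy : y ∈ S.carrier r) :
    E.mul h x y ∈ S.carrier t := by
  subst h
  rw [← S.map_V s r]
  exact ⟨_, HilbertTensor.tmul_mem_sub hx hy, rfl⟩

theorem Subsystem.le_of_mul_mem (S : Subsystem E) {s r t : ℝ≥0} (h : s + r = t)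
    {W : Submodule ℂ (E.space t)} (hW : IsClosed (W : Set (E.space t)))
    (hm : ∀ x ∈ S.carrier s, ∀ y ∈ S.carrier r, E.mul h x y ∈ W) : S.carrier t ≤ W := by
  subst h
  rw [← S.map_V s r]
  exact E.V_mem_of_tmul_mem hW hm

/-- An idempotent unit vector of `E_0` is a left identity. -/
theorem mul_left_identity {e : E.space 0} (he : ‖e‖ = 1) (hee : E.mul (add_zero 0) e e = e)
    {t : ℝ≥0} (x : E.space t) : E.mul (zero_add t) e x = x := by
  have h := mul_mul (add_zero 0) (zero_add t) (zero_add t) (zero_add t) e e x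
  rw [hee] at h
  -- Left multiplication by `e` is idempotent by associativity and isometric since `‖e‖ = 1`, hence
  -- the identity.
  have h' : E.mul (zero_add t) e (x - E.mul (zero_add t) e x) = 0 := by
    rw [map_sub, ← h, sub_self]
  have := norm_mul (zero_add t) e (x - E.mul (zero_add t) e x)
  rw [h', norm_zero, he, one_mul, eq_comm, norm_eq_zero, sub_eq_zero] at this
  exact this.symm

/-- An idempotent unit vector of `E_0` spans `E_0`. -/
theorem mem_span_identity {e : E.space 0} (he : ‖e‖ = 1) (hee : E.mul (add_zero 0) e e = e)
    (y : E.space 0) : y ∈ (ℂ ∙ e) := by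
  have hl := mul_left_identity he hee y
  have h : E.mul (zero_add 0) e (E.mul (zero_add 0) y e) = E.mul (zero_add 0) y e := by
    rw [← mul_mul (zero_add 0) (zero_add 0) (zero_add 0) (zero_add 0), hl]
  -- Injectivity of `V 0 0` turns `e(ye) = ye` into an equality of tensors; slicing it against `c ⊗
  -- e` yields `y = ⟨e, ye⟩ e`.
  have hinj : e ⊗ₕ E.mul (zero_add 0) y e = y ⊗ₕ e := by
    have h1 := (mul_eq_castIso (zero_add 0) e (E.mul (zero_add 0) y e)).symm.trans
      (h.trans (mul_eq_castIso (zero_add 0) y e))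
    exact (E.V 0 0).injective ((castIso E.space (zero_add 0)).injective h1)
  refine Submodule.mem_span_singleton.2 ⟨inner ℂ e (E.mul (zero_add 0) y e), ?_⟩
  refine ext_inner_left ℂ fun c => ?_
  have := congrArg (fun z => inner ℂ (c ⊗ₕ e) z) hinj
  simp only [HilbertTensor.inner_tmul] at this
  rw [inner_smul_right, mul_comm, this, inner_self_eq_norm_sq_to_K, he]
  simp

theorem mul_right_identity {e : E.space 0} (he : ‖e‖ = 1) (hee : E.mul (add_zero 0) e e = e)
    {t : ℝ≥0} (x : E.space t) : E.mul (add_zero t) x e = x := by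
  have h := mul_mul (add_zero t) (add_zero t) (add_zero 0) (add_zero t) x e e
  rw [hee] at h
  have h' : E.mul (add_zero t) (x - E.mul (add_zero t) x e) e = 0 := by
    rw [map_sub, sub_apply, h, sub_self]
  have := norm_mul (add_zero t) (x - E.mul (add_zero t) x e) e
  rw [h', norm_zero, he, mul_one, eq_comm, norm_eq_zero, sub_eq_zero] at this
  exact this.symm

end ArvesonSystem

/-! ### Consequences of separability: overlaps of units and exhaustion by unit slabs. -/

namespace ArvesonSystem

variable {E : ArvesonSystem.{u}} {F : ArvesonSystem.{v}}

/-- In a separable space there is no orthogonal family of nonzero vectors indexed by a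
nondegenerate interval. -/
theorem not_orthogonal_Iio {H : Type*} [NormedAddCommGroup H] [InnerProductSpace ℂ H]
    [TopologicalSpace.SeparableSpace H] {T : ℝ≥0} (hT : 0 < T) (y : Set.Iio T → H)
    (h0 : ∀ x, y x ≠ 0) (h : ∀ x x', x < x' → inner ℂ (y x) (y x') = 0) : False := by
  have hc : Countable (Set.Iio T) := by
    refine countable_of_pairwise_inner_eq_zero y h0 fun x x' hxx' => ?_
    rcases lt_or_gt_of_ne hxx' with hlt | hlt
    · exact h x x' hlt
    · exact inner_eq_zero_symm.1 (h x' x hlt)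
  have hT' : (0 : ℝ) < T := hT
  refine absurd (Cardinal.Real.Ico_countable_iff.1 (?_ : (Set.Ico (0 : ℝ) T).Countable)) (not_le.2 hT')
  refine ((Set.countable_coe_iff.1 hc).image ((↑) : ℝ≥0 → ℝ)).mono ?_
  rintro x ⟨hx0, hxT⟩
  exact ⟨⟨x, hx0⟩, hxT, rfl⟩

namespace UnitSection

theorem inner_mul (w w' : E.UnitSection) (s t : ℝ≥0) :
    inner ℂ (w.toFun (s + t)) (w'.toFun (s + t)) =
      inner ℂ (w.toFun s) (w'.toFun s) * inner ℂ (w.toFun t) (w'.toFun t) := by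
  rw [← w.mul_apply rfl, ← w'.mul_apply rfl, ArvesonSystem.inner_mul]

theorem norm_mul (w : E.UnitSection) {s t p : ℝ≥0} (h : s + t = p) :
    ‖w.toFun p‖ = ‖w.toFun s‖ * ‖w.toFun t‖ := by
  rw [← w.mul_apply h, ArvesonSystem.norm_mul]

/-- Two units are nowhere orthogonal where they do not vanish: otherwise
`x ↦ w_x w'_{t - x}` would be an uncountable orthogonal family. -/
theorem inner_ne_zero {w w' : E.UnitSection} (hw : w.IsUnital) {t : ℝ≥0} (ht : 0 < t)
    (h0 : w'.toFun t ≠ 0) : inner ℂ (w.toFun t) (w'.toFun t) ≠ 0 := by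
  intro hγ
  have hpow : ∀ (n : ℕ) (ε : ℝ≥0), inner ℂ (w.toFun (n • ε + ε)) (w'.toFun (n • ε + ε)) =
      inner ℂ (w.toFun ε) (w'.toFun ε) ^ (n + 1) := by
    intro n ε
    induction n with
    | zero => rw [zero_nsmul, zero_add, zero_add, pow_one]
    | succ n ih => rw [inner_mul, succ_nsmul, ih, ← pow_succ]
  -- Orthogonality at `t` spreads to all positive times: some multiple of `ε` exceeds `t`, where the
  -- overlap is a power of the overlap at `ε` and also has the overlap at `t` as a factor.
  have hall : ∀ ε, 0 < ε → inner ℂ (w.toFun ε) (w'.toFun ε) = 0 := by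
    intro ε hε
    obtain ⟨n, hn⟩ := Archimedean.arch t hε
    have hle : t ≤ n • ε + ε := hn.trans le_self_add
    obtain ⟨d, hd⟩ := exists_add_of_le hle
    have := hpow n ε
    rw [hd, inner_mul, hγ, zero_mul] at this
    exact eq_zero_of_pow_eq_zero this.symm
  have := E.separableSpace t
  refine not_orthogonal_Iio ht
    (fun x => E.mul (add_tsub_cancel_of_le x.2.le) (w.toFun x.1) (w'.toFun (t - x.1))) ?_ ?_
  · intro x
    have hx := w'.norm_mul (add_tsub_cancel_of_le x.2.le)
    rw [← norm_ne_zero_iff, ArvesonSystem.norm_mul, hw, one_mul]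
    exact (mul_ne_zero_iff.1 (hx ▸ norm_ne_zero_iff.2 h0)).2
  · intro x x' hlt
    -- Cut at `x` and `x'`: on the stretch between them one vector is `w'`, the other `w`, and these
    -- are orthogonal.
    have hx : x.1 + (x'.1 - x.1) = x'.1 := add_tsub_cancel_of_le (le_of_lt hlt)
    have hx' : (x'.1 - x.1) + (t - x'.1) = t - x.1 := by
      exact (add_comm _ _).trans (tsub_add_tsub_cancel (le_of_lt x'.2) (le_of_lt hlt))
    rw [← w.mul_apply hx, mul_mul hx (add_tsub_cancel_of_le x'.2.le) hx'
      (add_tsub_cancel_of_le x.2.le), ← w'.mul_apply hx', ArvesonSystem.inner_mul,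
      ArvesonSystem.inner_mul, inner_eq_zero_symm.1 (hall _ (tsub_pos_of_lt hlt)), zero_mul, mul_zero]

end UnitSection

/-- Values at most `1` make `g` decreasing, so no regularity is needed: with `n = ⌊t / ε⌋`, `g t ≤ g
ε ^ n`, and logarithms give `n (1 - g ε) ≤ -log (g t)`. -/
theorem exists_one_sub_le_of_multiplicative {g : ℝ≥0 → ℝ} (h0 : ∀ s, 0 ≤ g s)
    (h1 : ∀ s, g s ≤ 1) (hg : ∀ s t, g (s + t) = g s * g t) {t : ℝ≥0} (ht : 0 < t)
    (hgt : g t ≠ 0) : ∃ C : ℝ, 0 ≤ C ∧ ∀ ε ≤ t, 1 - g ε ≤ C * ε := by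
  have hgt' : 0 < g t := lt_of_le_of_ne (h0 t) hgt.symm
  have ht' : (0 : ℝ) < t := ht
  have hlog : Real.log (g t) ≤ 0 := Real.log_nonpos (h0 t) (h1 t)
  have hg0 : g 0 = 1 := by
    have := hg 0 t
    rw [zero_add] at this
    exact (mul_eq_right₀ hgt).1 this.symm
  have hpow : ∀ (n : ℕ) (ε : ℝ≥0), g (n • ε) = g ε ^ n := by
    intro n ε
    induction n with
    | zero => rw [zero_nsmul, hg0, pow_zero]
    | succ n ih => rw [succ_nsmul, hg, ih, pow_succ]
  have hanti : ∀ s r : ℝ≥0, s ≤ r → g r ≤ g s := by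
    intro s r hsr
    obtain ⟨d, rfl⟩ := exists_add_of_le hsr
    rw [hg]
    exact mul_le_of_le_one_right (h0 s) (h1 d)
  -- The factor `2` comes from `t < (n + 1) ε ≤ 2 n ε`, valid since `n ≥ 1`.
  refine ⟨2 * -Real.log (g t) / t, div_nonneg (by linarith) ht'.le, fun ε hε => ?_⟩
  rcases eq_or_ne ε 0 with rfl | hε0
  · simp [hg0]
  have hε' : (0 : ℝ) < ε := lt_of_le_of_ne ε.2 (by exact_mod_cast hε0.symm)
  have hgε : 0 < g ε := hgt'.trans_le (hanti _ _ hε)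
  have hdiv : (1 : ℝ) ≤ t / ε := (one_le_div hε').2 (by exact_mod_cast hε)
  set n := ⌊(t : ℝ) / ε⌋₊ with hn
  have hn1 : 1 ≤ n := Nat.le_floor (by exact_mod_cast hdiv)
  have hn1' : (1 : ℝ) ≤ n := by exact_mod_cast hn1
  have hnle : (n : ℝ) * ε ≤ t := (le_div_iff₀ hε').1 (Nat.floor_le (by positivity))
  have hlt : (t : ℝ) < (n + 1) * ε := (div_lt_iff₀ hε').1 (Nat.lt_floor_add_one _)
  have hle : g t ≤ g ε ^ n := by
    rw [← hpow]
    refine hanti _ _ ?_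
    rw [nsmul_eq_mul]
    exact_mod_cast hnle
  have hlogle : Real.log (g t) ≤ n * Real.log (g ε) := by
    rw [← Real.log_pow]
    exact Real.log_le_log hgt' hle
  have hsub : Real.log (g ε) ≤ g ε - 1 := Real.log_le_sub_one_of_pos hgε
  have h2 : n * (1 - g ε) ≤ -Real.log (g t) := by nlinarith
  rw [div_mul_eq_mul_div, le_div_iff₀ ht']
  have h3 : (1 - g ε) * t ≤ (1 - g ε) * (2 * n * ε) :=
    mul_le_mul_of_nonneg_left (by nlinarith) (by linarith [h1 ε])
  nlinarith

namespace UnitSection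

/-- The normalized overlap `|⟨w_ε, w'_ε⟩|² / ‖w'_ε‖²` of two units differs from `1` by `O(ε)`. -/
theorem exists_overlap_bound {w w' : E.UnitSection} (hw : w.IsUnital) {t : ℝ≥0} (ht : 0 < t)
    (h0 : w'.toFun t ≠ 0) : ∃ C : ℝ, 0 ≤ C ∧ ∀ s ε r : ℝ≥0, s + ε + r = t →
      (‖w'.toFun ε‖ ^ 2 - ‖inner ℂ (w.toFun ε) (w'.toFun ε)‖ ^ 2) *
        (‖w'.toFun s‖ ^ 2 * ‖w'.toFun r‖ ^ 2) ≤ C * ε := by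
  have hle : ∀ s, ‖inner ℂ (w.toFun s) (w'.toFun s)‖ ≤ ‖w'.toFun s‖ := fun s => by
    simpa [hw s] using norm_inner_le_norm (𝕜 := ℂ) (w.toFun s) (w'.toFun s)
  obtain ⟨C, hC0, hC⟩ := exists_one_sub_le_of_multiplicative
    (g := fun s => ‖inner ℂ (w.toFun s) (w'.toFun s)‖ ^ 2 / ‖w'.toFun s‖ ^ 2)
    (fun s => by positivity)
    (fun s => div_le_one_of_le₀ (pow_le_pow_left₀ (norm_nonneg _) (hle s) 2) (by positivity))
    (fun s r => by
      rw [inner_mul, w'.norm_mul (rfl : s + r = s + r), _root_.norm_mul, mul_pow, mul_pow,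
        mul_div_mul_comm]) ht
    (div_ne_zero (pow_ne_zero _ (norm_ne_zero_iff.2 (inner_ne_zero hw ht h0)))
      (pow_ne_zero _ (norm_ne_zero_iff.2 h0)))
  -- Since `‖w'_t‖` is the product of the norms at `s`, `ε` and `r`, this factor clears the
  -- denominator of the normalized overlap.
  refine ⟨C * ‖w'.toFun t‖ ^ 2, by positivity, fun s ε r h => ?_⟩
  have hφ : ‖w'.toFun t‖ = ‖w'.toFun s‖ * ‖w'.toFun ε‖ * ‖w'.toFun r‖ := by
    rw [w'.norm_mul h, w'.norm_mul (rfl : s + ε = s + ε)]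
  have hφε : ‖w'.toFun ε‖ ≠ 0 := by
    intro h'
    rw [h', mul_zero, zero_mul, norm_eq_zero] at hφ
    exact h0 hφ
  have hεt : ε ≤ t := by rw [← h]; exact le_add_self.trans le_self_add
  have hCε := mul_le_mul_of_nonneg_right (hC ε hεt) (by positivity : 0 ≤ ‖w'.toFun t‖ ^ 2)
  refine le_trans (le_of_eq ?_) (hCε.trans (le_of_eq (by ring)))
  rw [hφ]
  field_simp

end UnitSection

/-- A vector orthogonal to all `v_ε F_{T - ε}`, `ε > 0`, vanishes: otherwise `x ↦ v_x z_{T - x}`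
would be an uncountable orthogonal family. -/
theorem eq_zero_of_inner_unit_mul_eq_zero {w : F.UnitSection} (hw : w.IsUnital) {T : ℝ≥0}
    (hT : 0 < T) {z : F.space T} (hz : ∀ (ε r : ℝ≥0) (h : ε + r = T), 0 < ε → ∀ c : F.space r,
      inner ℂ (F.mul h (w.toFun ε) c) z = 0) : z = 0 := by
  by_contra hz0
  have key : ∀ x : Set.Iio T, ∃ y : F.space (T - x.1), y ≠ 0 ∧
      ∀ (ε r : ℝ≥0) (h : ε + r = T - x.1), 0 < ε → ∀ c : F.space r,
        inner ℂ (F.mul h (w.toFun ε) c) y = 0 := by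
    intro x
    set W : Submodule ℂ (F.space (T - x.1)) := (Submodule.span ℂ {b | ∃ (ε r : ℝ≥0)
      (h : ε + r = T - x.1), 0 < ε ∧ ∃ c, b = F.mul h (w.toFun ε) c}).topologicalClosure with hW
    by_contra! hcon
    have hWtop : W = ⊤ := by
      rw [hW, Submodule.topologicalClosure_eq_top_iff, Submodule.eq_bot_iff]
      intro y hy
      by_contra hy0
      obtain ⟨ε, r, h, hε, c, hc⟩ := hcon y hy0
      exact hc (hy _ (Submodule.subset_span ⟨ε, r, h, hε, c, rfl⟩))
    have hx : T - x.1 + x.1 = T := tsub_add_cancel_of_le x.2.le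
    -- If the vectors `v_ε c` were total in `F_{T-x}`, the products `(v_ε c) d = v_ε (c d)`, all
    -- orthogonal to `z`, would be total in `F_T`.
    have htop : LinearMap.ker (innerSL ℂ z).toLinearMap = ⊤ := by
      refine eq_top_of_mul_mem hx _ (ContinuousLinearMap.isClosed_ker _) fun b d => ?_
      have hb : W ≤ (LinearMap.ker (innerSL ℂ z).toLinearMap).comap
          ((F.mul hx).flip d).toLinearMap := by
        refine Submodule.topologicalClosure_minimal _ (Submodule.span_le.2 ?_)
          ((ContinuousLinearMap.isClosed_ker _).preimage (ContinuousLinearMap.continuous _))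
        rintro _ ⟨ε, r, h, hε, c, rfl⟩
        have hr : ε + (r + x.1) = T := by rw [← add_assoc, h, hx]
        change inner ℂ z (F.mul hx (F.mul h (w.toFun ε) c) d) = 0
        rw [mul_mul h hx rfl hr]
        exact inner_eq_zero_symm.1 (hz _ _ hr hε _)
      exact hb (hWtop ▸ Submodule.mem_top)
    have : z ∈ LinearMap.ker (innerSL ℂ z).toLinearMap := htop ▸ Submodule.mem_top
    exact hz0 (inner_self_eq_zero.1 this)
  choose y hy0 hy using key
  have := F.separableSpace T
  refine not_orthogonal_Iio hT
    (fun x => F.mul (add_tsub_cancel_of_le x.2.le) (w.toFun x.1) (y x)) ?_ ?_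
  · intro x
    rw [← norm_ne_zero_iff, norm_mul, hw, one_mul]
    exact norm_ne_zero_iff.2 (hy0 x)
  · intro x x' hlt
    -- After the common factor `v_x`, compare `y_x` with `v_{x'-x} y_{x'}`: orthogonal by the choice
    -- of `y_x`.
    have hx : x.1 + (x'.1 - x.1) = x'.1 := add_tsub_cancel_of_le (le_of_lt hlt)
    have hx' : (x'.1 - x.1) + (T - x'.1) = T - x.1 := by
      exact (add_comm _ _).trans (tsub_add_tsub_cancel (le_of_lt x'.2) (le_of_lt hlt))
    rw [← w.mul_apply hx, mul_mul hx (add_tsub_cancel_of_le x'.2.le) hx'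
      (add_tsub_cancel_of_le x.2.le), inner_mul,
      inner_eq_zero_symm.1 (hy x _ _ hx' (tsub_pos_of_lt hlt) _), mul_zero]

/-- The closed subspace `F_s v_ε F_{t - s - ε}` of `F_t`. -/
noncomputable def unitSlab (w : F.UnitSection) (t s ε : ℝ≥0) : Submodule ℂ (F.space t) :=
  (Submodule.span ℂ {x | ∃ (r p : ℝ≥0) (h₁ : ε + r = p) (h₂ : s + p = t) (a : F.space s)
    (c : F.space r), x = F.mul h₂ a (F.mul h₁ (w.toFun ε) c)}).topologicalClosure

/-- A longer stretch of the unit factors, and its excess is absorbed into the last factor. -/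
theorem unitSlab_antitone (w : F.UnitSection) (t s : ℝ≥0) : Antitone (unitSlab w t s) := by
  intro ε ε' hle
  refine Submodule.topologicalClosure_mono (Submodule.span_mono ?_)
  rintro _ ⟨r, p, h₁, h₂, a, c, rfl⟩
  obtain ⟨d, rfl⟩ := exists_add_of_le hle
  have h : ε + (d + r) = p := by rw [← add_assoc, h₁]
  refine ⟨d + r, p, h, h₂, a, F.mul rfl (w.toFun d) c, ?_⟩
  rw [← w.mul_apply rfl, mul_mul rfl h₁ rfl h]

/-- The subspaces `F_s v_ε F_{t - s - ε}` exhaust `F_t` as `ε → 0`. -/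
theorem exists_mem_unitSlab {w : F.UnitSection} (hw : w.IsUnital) {t s : ℝ≥0} (hst : s < t)
    (f : F.space t) {η : ℝ} (hη : 0 < η) :
    ∃ ε₀ > 0, ∀ ε ≤ ε₀, ∃ q ∈ unitSlab w t s ε, ‖f - q‖ < η := by
  have : Nonempty {ε : ℝ≥0 // 0 < ε} := ⟨⟨1, one_pos⟩⟩
  set U : {ε : ℝ≥0 // 0 < ε} → Submodule ℂ (F.space t) := fun ε => unitSlab w t s ε with hU
  have hdir : Directed (· ≤ ·) U := fun a b =>
    ⟨⟨min a.1 b.1, lt_min a.2 b.2⟩, unitSlab_antitone w t s (min_le_left _ _),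
      unitSlab_antitone w t s (min_le_right _ _)⟩
  have htop : (⨆ ε, U ε).topologicalClosure = ⊤ := by
    have hs : s + (t - s) = t := add_tsub_cancel_of_le hst.le
    refine eq_top_of_mul_mem hs _ (Submodule.isClosed_topologicalClosure _) fun a b => ?_
    set W := (⨆ ε, U ε).topologicalClosure.comap (F.mul hs a).toLinearMap with hW
    have hWcl : IsClosed (W : Set (F.space (t - s))) :=
      (Submodule.isClosed_topologicalClosure _).preimage (F.mul hs a).continuous
    have hWtop : W = ⊤ := by
      have := hWcl.completeSpace_coe
      rw [← Submodule.orthogonal_eq_bot_iff, Submodule.eq_bot_iff]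
      intro z hz
      refine eq_zero_of_inner_unit_mul_eq_zero hw (tsub_pos_of_lt hst) fun ε r h hε c => ?_
      refine hz _ (Submodule.le_topologicalClosure _ ?_)
      refine Submodule.mem_iSup_of_mem ⟨ε, hε⟩ (Submodule.le_topologicalClosure _ ?_)
      exact Submodule.subset_span ⟨r, _, h, hs, a, c, rfl⟩
    have hb : b ∈ W := hWtop ▸ Submodule.mem_top
    exact hb
  have hf : f ∈ (⨆ ε, U ε).topologicalClosure := htop ▸ Submodule.mem_top
  obtain ⟨q, hq, hfq⟩ := Metric.mem_closure_iff.1 hf η hη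
  obtain ⟨ε₀, hq⟩ := (Submodule.mem_iSup_of_directed U hdir).1 hq
  -- By antitonicity a single `q` serves all `ε ≤ ε₀`.
  exact ⟨ε₀.1, ε₀.2, fun ε hε => ⟨q, unitSlab_antitone w t s hε hq, by rwa [← dist_eq_norm]⟩⟩

end ArvesonSystem

/-! ### A growth criterion in one real variable. -/

/-- A function on `[0, t]` that starts at `0`, is Lipschitz, and grows at most with an arbitrarily
small slope to the right of every point is nonpositive at `t`. -/
theorem nonpos_of_right_slope {t : ℝ≥0} {D : ℝ≥0 → ℝ} {C : ℝ} (hD0 : D 0 = 0)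
    (hmono : ∀ s ε, s + ε ≤ t → D s ≤ D (s + ε))
    (hlip : ∀ s ε, s + ε ≤ t → D (s + ε) ≤ D s + C * ε)
    (hslope : ∀ s < t, ∀ η > (0 : ℝ), ∃ ε₀ > 0, ∀ ε ≤ ε₀, s + ε ≤ t →
      D (s + ε) ≤ D s + η * ε) : D t ≤ 0 := by
  have hdist : ∀ a b : ℝ, a ∈ Set.Icc 0 (t : ℝ) → b ∈ Set.Icc 0 (t : ℝ) → a ≤ b →
      dist (D a.toNNReal) (D b.toNNReal) ≤ C.toNNReal * dist a b := by
    intro a b ha hb hab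
    have hsum : a.toNNReal + (b - a).toNNReal = b.toNNReal := by
      rw [← Real.toNNReal_add ha.1 (sub_nonneg.2 hab), add_sub_cancel]
    have hle : a.toNNReal + (b - a).toNNReal ≤ t := by
      rw [hsum]
      exact Real.toNNReal_le_iff_le_coe.2 hb.2
    have h1 := hmono _ _ hle
    have h2 := hlip _ _ hle
    rw [hsum, Real.coe_toNNReal _ (sub_nonneg.2 hab)] at h2
    rw [hsum] at h1
    rw [dist_comm, Real.dist_eq, abs_of_nonneg (sub_nonneg.2 h1), dist_comm, Real.dist_eq,
      abs_of_nonneg (sub_nonneg.2 hab)]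
    have := mul_le_mul_of_nonneg_right (Real.le_coe_toNNReal C) (sub_nonneg.2 hab)
    linarith
  have hcont : ContinuousOn (fun a : ℝ => D a.toNNReal) (Set.Icc 0 (t : ℝ)) := by
    refine (LipschitzOnWith.of_dist_le_mul (K := C.toNNReal) fun a ha b hb => ?_).continuousOn
    rcases le_total a b with hab | hab
    · exact hdist a b ha hb hab
    · rw [dist_comm, dist_comm a b]
      exact hdist b a hb ha hab
  have := image_le_of_liminf_slope_right_le_deriv_boundary hcont (B := fun _ => 0)
    (B' := fun _ => 0) (by simp [hD0]) continuousOn_const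
    (fun x _ => hasDerivWithinAt_const _ _ _) (fun x hx r hr => ?_)
    (Set.right_mem_Icc.2 t.2)
  · simpa using this
  -- The comparison theorem wants slopes strictly below `r`, hence `r / 2`.
  · obtain ⟨ε₀, hε₀, h⟩ := hslope x.toNNReal
      ((Real.toNNReal_lt_iff_lt_coe hx.1).2 hx.2) (r / 2) (half_pos hr)
    refine Filter.Eventually.frequently ?_
    filter_upwards [Ioo_mem_nhdsGT (lt_min hx.2 (lt_add_of_pos_right x (NNReal.coe_pos.2 hε₀)))]
      with z hz
    have hxz : 0 < z - x := sub_pos.2 hz.1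
    have hsum : x.toNNReal + (z - x).toNNReal = z.toNNReal := by
      rw [← Real.toNNReal_add hx.1 hxz.le, add_sub_cancel]
    have hz' := lt_min_iff.1 hz.2
    have hb := h (z - x).toNNReal
      (Real.toNNReal_le_iff_le_coe.2 (by linarith [hz'.2]))
      (by rw [hsum]; exact Real.toNNReal_le_iff_le_coe.2 hz'.1.le)
    rw [hsum, Real.coe_toNNReal _ hxz.le] at hb
    rw [slope_def_field, div_lt_iff₀ hxz]
    nlinarith

/-! ### Pairings, slabs, and spreading from one unit to all units. -/

namespace ArvesonSystem

universe u₁ u₂ u₃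

variable {E : ArvesonSystem.{u₁}} {F : ArvesonSystem.{u₂}} {G : ArvesonSystem.{u₃}}

/-- A family of bilinear maps `E_t × F_t → G_t` that behave like elementary tensors: they are
isometric and multiplicative. -/
structure Pairing (E : ArvesonSystem.{u₁}) (F : ArvesonSystem.{u₂}) (G : ArvesonSystem.{u₃}) where
  /-- The bilinear maps. -/
  toFun : ∀ t, E.space t →L[ℂ] F.space t →L[ℂ] G.space t
  inner_apply : ∀ t a b a' b',
    inner ℂ (toFun t a b) (toFun t a' b') = inner ℂ a a' * inner ℂ b b'
  V_apply : ∀ s t a b c d, toFun (s + t) (E.V s t (a ⊗ₕ c)) (F.V s t (b ⊗ₕ d)) =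
    G.V s t (toFun s a b ⊗ₕ toFun t c d)

namespace Pairing

variable (m : Pairing E F G)

theorem norm_apply (t : ℝ≥0) (a : E.space t) (b : F.space t) :
    ‖m.toFun t a b‖ = ‖a‖ * ‖b‖ := by
  have := m.inner_apply t a b a b
  simp only [inner_self_eq_norm_sq_to_K] at this
  norm_cast at this
  rw [← mul_pow] at this
  exact (sq_eq_sq₀ (norm_nonneg _) (by positivity)).1 this

theorem mul_apply {s r t : ℝ≥0} (h : s + r = t) (a : E.space s) (b : F.space s) (c : E.space r)
    (d : F.space r) : m.toFun t (E.mul h a c) (F.mul h b d) =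
      G.mul h (m.toFun s a b) (m.toFun r c d) := by
  subst h
  exact m.V_apply s r a b c d

end Pairing

namespace Subsystem

/-- The closed subspace `S_s G_{t - s}` of `G_t`. -/
noncomputable def slab (S : Subsystem G) (t s : ℝ≥0) : Submodule ℂ (G.space t) :=
  (Submodule.span ℂ {x | ∃ (r : ℝ≥0) (h : s + r = t), ∃ y ∈ S.carrier s, ∃ z,
    x = G.mul h y z}).topologicalClosure

theorem isClosed_slab (S : Subsystem G) (t s : ℝ≥0) :
    IsClosed (S.slab t s : Set (G.space t)) := Submodule.isClosed_topologicalClosure _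

theorem mul_mem_slab (S : Subsystem G) {t s r : ℝ≥0} (h : s + r = t) {y : G.space s}
    (hy : y ∈ S.carrier s) (z : G.space r) : G.mul h y z ∈ S.slab t s :=
  Submodule.le_topologicalClosure _ (Submodule.subset_span ⟨r, h, y, hy, z, rfl⟩)

noncomputable instance (S : Subsystem G) (t s : ℝ≥0) :
    (S.slab t s).HasOrthogonalProjection :=
  have := (S.isClosed_slab t s).completeSpace_coe
  inferInstance

noncomputable instance (S : Subsystem G) (t : ℝ≥0) :
    (S.carrier t).HasOrthogonalProjection :=
  have := (S.isClosed t).completeSpace_coe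
  inferInstance

/-- `S_{s+d}` is the closed span of `S_s S_d`, and the factor from `S_d` can be moved into the free
part. -/
theorem slab_antitone (S : Subsystem G) (t : ℝ≥0) : Antitone (S.slab t) := by
  intro s s' hle
  obtain ⟨d, rfl⟩ := exists_add_of_le hle
  refine Submodule.topologicalClosure_minimal _ (Submodule.span_le.2 ?_) (S.isClosed_slab t s)
  rintro _ ⟨r, h, y, hy, z, rfl⟩
  have hcl : IsClosed ((S.slab t s).comap ((G.mul h).flip z).toLinearMap :
      Set (G.space (s + d))) := (S.isClosed_slab t s).preimage ((G.mul h).flip z).continuous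
  refine S.le_of_mul_mem rfl hcl (fun a ha b _ => ?_) hy
  change G.mul h (G.mul rfl a b) z ∈ S.slab t s
  rw [mul_mul rfl h rfl (by rw [← add_assoc, h])]
  exact S.mul_mem_slab _ ha _

/-- The projection onto `S_s G_{t - s}` is the projection onto `S_s` on the first factor. -/
theorem starProjection_slab_mul (S : Subsystem G) {t s r : ℝ≥0} (h : s + r = t) (a : G.space s)
    (z : G.space r) : (S.slab t s).starProjection (G.mul h a z) =
      G.mul h ((S.carrier s).starProjection a) z := by
  refine Submodule.eq_starProjection_of_mem_orthogonal
    (S.mul_mem_slab h (Submodule.starProjection_apply_mem _ _) z) ?_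
  rw [slab, Submodule.orthogonal_closure]
  refine (Submodule.mem_orthogonal _ _).2 fun x hx => ?_
  have hle : Submodule.span ℂ {x | ∃ (r : ℝ≥0) (h : s + r = t), ∃ y ∈ S.carrier s, ∃ z,
      x = G.mul h y z} ≤ LinearMap.ker (innerSL ℂ (G.mul h a z -
        G.mul h ((S.carrier s).starProjection a) z)).toLinearMap := by
    refine Submodule.span_le.2 ?_
    rintro _ ⟨r', h', y, hy, z', rfl⟩
    obtain rfl : r' = r := add_left_cancel (h'.trans h.symm)
    change inner ℂ (G.mul h a z - G.mul h ((S.carrier s).starProjection a) z) (G.mul h y z') = 0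
    rw [← sub_apply, ← map_sub, inner_mul, Submodule.inner_left_of_mem_orthogonal hy
      (Submodule.sub_starProjection_mem_orthogonal _), zero_mul]
  exact inner_eq_zero_symm.1 (hle hx)

end Subsystem

theorem norm_sub_smul_sq {H : Type*} [NormedAddCommGroup H] [InnerProductSpace ℂ H] {x : H}
    (hx : ‖x‖ = 1) (y : H) :
    ‖y - inner ℂ x y • x‖ ^ 2 = ‖y‖ ^ 2 - ‖inner ℂ x y‖ ^ 2 := by
  have h := norm_add_sq_eq_norm_sq_add_norm_sq_of_inner_eq_zero (𝕜 := ℂ)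
    (y - inner ℂ x y • x) (inner ℂ x y • x) (by
      rw [inner_smul_right, inner_sub_left, inner_smul_left, inner_self_eq_norm_sq_to_K, hx,
        inner_conj_symm]
      simp)
  rw [sub_add_cancel, norm_smul, hx] at h
  nlinarith

section spreading

variable (m : Pairing E F G) (S : Subsystem G) {w w' : E.UnitSection} {v : F.UnitSection}

/-- The square of the distance of `x` to `S_s G_{t - s}`. -/
noncomputable def slabDist (S : Subsystem G) {t : ℝ≥0} (x : G.space t) (s : ℝ≥0) : ℝ :=
  ‖x - (S.slab t s).starProjection x‖ ^ 2

theorem slabDist_mono {t : ℝ≥0} (x : G.space t) (s ε : ℝ≥0) :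
    slabDist S x s ≤ slabDist S x (s + ε) := by
  refine pow_le_pow_left₀ (norm_nonneg _) ?_ 2
  rw [Submodule.starProjection_minimal]
  exact ciInf_le ⟨0, Set.forall_mem_range.2 fun _ => norm_nonneg _⟩
    (⟨_, S.slab_antitone t le_self_add (Submodule.starProjection_apply_mem _ x)⟩ : S.slab t s)

/-- With `P` the projection onto the slab at `s`, `P n` competes for the distance at `s'`, and `x -
P n` splits orthogonally as `(x - P x) + P (x - n)`. Squares matter: the error `‖x - n‖²` will be of
order `ε`, whereas unsquared distances would lose `√ε` per step. -/
theorem slabDist_le {t : ℝ≥0} (x n : G.space t) (s s' : ℝ≥0)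
    (hn : (S.slab t s).starProjection n ∈ S.slab t s') :
    slabDist S x s' ≤ slabDist S x s + ‖x - n‖ ^ 2 := by
  have h1 : ‖x - (S.slab t s').starProjection x‖ ≤ ‖x - (S.slab t s).starProjection n‖ := by
    rw [Submodule.starProjection_minimal]
    exact ciInf_le ⟨0, Set.forall_mem_range.2 fun _ => norm_nonneg _⟩
      (⟨_, hn⟩ : S.slab t s')
  have h2 := norm_add_sq_eq_norm_sq_add_norm_sq_of_inner_eq_zero (𝕜 := ℂ)
    (x - (S.slab t s).starProjection x) ((S.slab t s).starProjection (x - n))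
    (Submodule.inner_left_of_mem_orthogonal (Submodule.starProjection_apply_mem _ _)
      (Submodule.sub_starProjection_mem_orthogonal _))
  rw [map_sub, sub_add_sub_cancel, ← map_sub] at h2
  have h3 : ‖(S.slab t s).starProjection (x - n)‖ ≤ ‖x - n‖ :=
    Submodule.norm_starProjection_apply_le _ _
  have h4 := pow_le_pow_left₀ (norm_nonneg _) h1 2
  have h5 := pow_le_pow_left₀ (norm_nonneg _) h3 2
  unfold slabDist
  nlinarith

/-- Compare `w'_t ⊗ f` with a vector whose factor over the interval of length `ε` lies in `S_ε`:
through `v_ε` on the part `q`, and through `w_ε` on `f - q`. -/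
theorem slabDist_add_le (hw : w.IsUnital) (hS : ∀ t f, m.toFun t (w.toFun t) f ∈ S.carrier t)
    (hS' : ∀ t e, m.toFun t e (v.toFun t) ∈ S.carrier t) {t s ε r : ℝ≥0} (h : s + ε + r = t)
    (f : F.space t) {q : F.space t} (hq : q ∈ unitSlab v t s ε) :
    slabDist S (m.toFun t (w'.toFun t) f) (s + ε) ≤
      slabDist S (m.toFun t (w'.toFun t) f) s +
        (‖w'.toFun ε‖ ^ 2 - ‖inner ℂ (w.toFun ε) (w'.toFun ε)‖ ^ 2) *
        (‖w'.toFun s‖ ^ 2 * ‖w'.toFun r‖ ^ 2) * ‖f - q‖ ^ 2 := by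
  have h' : s + (ε + r) = t := by rw [← add_assoc, h]
  -- The projection acts on the first factor only, so the result lies in `S_s S_ε G_r`.
  have hmem : ∀ (a : G.space s) (b : G.space ε) (c : G.space r), b ∈ S.carrier ε →
      (S.slab t s).starProjection (G.mul h' a (G.mul rfl b c)) ∈ S.slab t (s + ε) := by
    intro a b c hb
    rw [S.starProjection_slab_mul, ← mul_mul rfl h]
    exact S.mul_mem_slab h (S.mul_mem rfl (Submodule.starProjection_apply_mem _ _) hb) c
  set T : Submodule ℂ (G.space t) := (S.slab t (s + ε)).comap
    (S.slab t s).starProjection.toLinearMap with hT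
  have hTcl : IsClosed (T : Set (G.space t)) :=
    (S.isClosed_slab t (s + ε)).preimage (S.slab t s).starProjection.continuous
  -- The vector `w'_t` with its middle stretch replaced by `w_ε`.
  set e := E.mul h' (w'.toFun s) (E.mul rfl (w.toFun ε) (w'.toFun r)) with he
  have hwt : w'.toFun t = E.mul h' (w'.toFun s) (E.mul rfl (w'.toFun ε) (w'.toFun r)) := by
    rw [w'.mul_apply, w'.mul_apply]
  have hq' : m.toFun t (w'.toFun t) q ∈ T := by
    have hcl : IsClosed (T.comap (m.toFun t (w'.toFun t)).toLinearMap : Set (F.space t)) :=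
      hTcl.preimage (m.toFun t (w'.toFun t)).continuous
    refine Submodule.topologicalClosure_minimal _ (Submodule.span_le.2 ?_) hcl hq
    rintro _ ⟨r', p, h₁, h₂, a, c, rfl⟩
    obtain rfl : p = ε + r := add_left_cancel (h₂.trans h'.symm)
    obtain rfl : r' = r := add_left_cancel h₁
    change m.toFun t (w'.toFun t) (F.mul h' a (F.mul rfl (v.toFun ε) c)) ∈ T
    rw [hwt, m.mul_apply, m.mul_apply]
    exact hmem _ _ _ (hS' _ _)
  have he' : ∀ g, m.toFun t e g ∈ T := by
    have hcl : IsClosed (T.comap (m.toFun t e).toLinearMap : Set (F.space t)) :=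
      hTcl.preimage (m.toFun t e).continuous
    have htop : T.comap (m.toFun t e).toLinearMap = ⊤ := by
      refine eq_top_of_mul_mem h' _ hcl fun a g => ?_
      have hcl' : IsClosed ((T.comap (m.toFun t e).toLinearMap).comap
          (F.mul h' a).toLinearMap : Set (F.space (ε + r))) :=
        hcl.preimage (F.mul h' a).continuous
      have htop' := eq_top_of_mul_mem rfl _ hcl' fun b c => by
        change m.toFun t e (F.mul h' a (F.mul rfl b c)) ∈ T
        rw [he, m.mul_apply, m.mul_apply]
        exact hmem _ _ _ (hS _ _)
      have hg : g ∈ (T.comap (m.toFun t e).toLinearMap).comap (F.mul h' a).toLinearMap :=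
        htop' ▸ Submodule.mem_top
      exact hg
    intro g
    have hg : g ∈ T.comap (m.toFun t e).toLinearMap := htop ▸ Submodule.mem_top
    exact hg
  set l := inner ℂ (w.toFun ε) (w'.toFun ε) with hl
  -- Here `l w_ε` is the projection of `w'_ε` onto `ℂ w_ε`, so the difference from `w'_t ⊗ f`
  -- retains only the component of `w'_ε` orthogonal to `w_ε`, tensored with `f - q`.
  have hn : m.toFun t (w'.toFun t) q + l • m.toFun t e (f - q) ∈ T :=
    T.add_mem hq' (T.smul_mem _ (he' _))
  refine (slabDist_le S _ _ s (s + ε) hn).trans (le_of_eq ?_)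
  have hdiff : m.toFun t (w'.toFun t) f - (m.toFun t (w'.toFun t) q + l • m.toFun t e (f - q)) =
      m.toFun t (E.mul h' (w'.toFun s) (E.mul rfl (w'.toFun ε - l • w.toFun ε) (w'.toFun r)))
        (f - q) := by
    simp only [map_sub, map_smul, sub_apply, smul_apply, hwt, he]
    module
  rw [hdiff, m.norm_apply, norm_mul, norm_mul, mul_pow, mul_pow, mul_pow,
    norm_sub_smul_sq (hw ε)]
  ring

/-- If a subsystem of `G` contains `w ⊗ F` and `E ⊗ v` for unital units `w`, `v`, then it contains
`w' ⊗ F` for every unit `w'` of `E`. -/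
theorem Pairing.unit_mem (hw : w.IsUnital) (hv : v.IsUnital)
    (hS : ∀ t f, m.toFun t (w.toFun t) f ∈ S.carrier t)
    (hS' : ∀ t e, m.toFun t e (v.toFun t) ∈ S.carrier t) (t : ℝ≥0) (f : F.space t) :
    m.toFun t (w'.toFun t) f ∈ S.carrier t := by
  set i := m.toFun 0 (w.toFun 0) (v.toFun 0) with hi
  have hi1 : ‖i‖ = 1 := by rw [hi, m.norm_apply, hw, hv, one_mul]
  have hii : G.mul (add_zero 0) i i = i := by
    rw [hi, ← m.mul_apply, w.mul_apply, v.mul_apply]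
  set x := m.toFun t (w'.toFun t) f with hx
  -- The left identity `i` lies in `S_0`, so the slab at time `0` is everything.
  have hslab0 : slabDist S x 0 = 0 := by
    have : x ∈ S.slab t 0 := by
      rw [← mul_left_identity hi1 hii x]
      exact S.mul_mem_slab _ (hS _ _) _
    rw [slabDist, Submodule.starProjection_eq_self_iff.2 this, sub_self, norm_zero]
    norm_num
  have hslabt : slabDist S x t ≤ 0 → x ∈ S.carrier t := by
    intro h
    have h0 : x = (S.slab t t).starProjection x := by
      rw [← sub_eq_zero, ← norm_eq_zero, ← sq_eq_zero_iff]
      exact le_antisymm h (by positivity)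
    -- The remaining factor lies in `G_0 = ℂ i`, and `i` is a right identity.
    have hle : S.slab t t ≤ S.carrier t := by
      refine Submodule.topologicalClosure_minimal _ (Submodule.span_le.2 ?_) (S.isClosed t)
      rintro _ ⟨r, h, y, hy, z, rfl⟩
      obtain rfl : r = 0 := add_left_cancel (h.trans (add_zero t).symm)
      obtain ⟨a, rfl⟩ := Submodule.mem_span_singleton.1 (mem_span_identity hi1 hii z)
      rw [map_smul, mul_right_identity hi1 hii]
      exact (S.carrier t).smul_mem _ hy
    rw [h0]
    exact hle (Submodule.starProjection_apply_mem _ _)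
  refine hslabt ?_
  rcases eq_or_ne (w'.toFun t) 0 with h0 | h0
  · simp [slabDist, hx, h0]
  rcases eq_or_ne t 0 with rfl | ht
  · exact hslab0.le
  obtain ⟨C, hC0, hC⟩ := UnitSection.exists_overlap_bound hw (pos_iff_ne_zero.2 ht) h0
  have hstep : ∀ s ε, s + ε ≤ t → ∀ q ∈ unitSlab v t s ε,
      slabDist S x (s + ε) ≤ slabDist S x s + C * ε * ‖f - q‖ ^ 2 := by
    intro s ε hle q hq
    obtain ⟨r, hr⟩ := exists_add_of_le hle
    refine (slabDist_add_le m S (w' := w') hw hS hS' hr.symm f hq).trans ?_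
    linarith [mul_le_mul_of_nonneg_right (hC s ε r hr.symm) (sq_nonneg ‖f - q‖)]
  refine nonpos_of_right_slope (C := C * ‖f‖ ^ 2) hslab0 (fun s ε _ => slabDist_mono S x s ε)
    (fun s ε hle => ?_) (fun s hs η hη => ?_)
  -- The crude choice `q = 0` gives the Lipschitz bound.
  · refine (hstep s ε hle 0 (Submodule.zero_mem _)).trans (le_of_eq ?_)
    rw [sub_zero]
    ring
  -- A good approximation `q` makes the slope at most `η`; dividing by `C + 1` avoids the case `C =
  -- 0`.
  · obtain ⟨ε₀, hε₀, h⟩ := exists_mem_unitSlab hv hs f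
      (Real.sqrt_pos.2 (div_pos hη (by linarith : 0 < C + 1)))
    refine ⟨ε₀, hε₀, fun ε hε hle => ?_⟩
    obtain ⟨q, hq, hfq⟩ := h ε hε
    refine (hstep s ε hle q hq).trans ?_
    have h1 : ‖f - q‖ ^ 2 ≤ η / (C + 1) := by
      rw [← Real.sq_sqrt (by positivity : 0 ≤ η / (C + 1))]
      exact pow_le_pow_left₀ (norm_nonneg _) hfq.le 2
    have h2 : C * ‖f - q‖ ^ 2 ≤ η := by
      calc C * ‖f - q‖ ^ 2 ≤ (C + 1) * (η / (C + 1)) := by gcongr; linarith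
        _ = η := by field_simp
    nlinarith [mul_le_mul_of_nonneg_right h2 ε.2]

end spreading

end ArvesonSystem

/-! ### From units to the subsystem they generate. -/

namespace ArvesonSystem

universe u₁ u₂ u₃

/-- Products of values of units. -/
inductive IsUnitProduct (E : ArvesonSystem.{u}) : ∀ t, E.space t → Prop
  | unit (w : E.UnitSection) (t : ℝ≥0) : IsUnitProduct E t (w.toFun t)
  | mul {s r t : ℝ≥0} (h : s + r = t) (x : E.space s) (w : E.UnitSection) :
    IsUnitProduct E s x → IsUnitProduct E t (E.mul h x (w.toFun r))

namespace IsUnitProduct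

variable {E : ArvesonSystem.{u}}

theorem mul_mem {s r t : ℝ≥0} (h : s + r = t) {x : E.space s} {y : E.space r}
    (hx : IsUnitProduct E s x) (hy : IsUnitProduct E r y) :
    IsUnitProduct E t (E.mul h x y) := by
  induction hy generalizing t with
  | unit w r => exact mul h x w hx
  | @mul a b r hab z w _ ih =>
    have h' : s + a + b = t := by rw [add_assoc, hab, h]
    rw [← mul_mul rfl h' hab h]
    exact mul h' _ w (ih rfl)

/-- A product of units at time `s + r` splits at time `s`. -/
theorem exists_eq_mul {t : ℝ≥0} {x : E.space t} (hx : IsUnitProduct E t x) {s r : ℝ≥0}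
    (h : s + r = t) : ∃ y z, IsUnitProduct E s y ∧ IsUnitProduct E r z ∧ x = E.mul h y z := by
  induction hx generalizing s r with
  | unit w t => exact ⟨_, _, unit w s, unit w r, (w.mul_apply h).symm⟩
  | @mul a b t hab x w hx ih =>
    -- The cut falls either in the earlier product, handled by induction, or inside the last unit,
    -- which itself factors.
    rcases le_total s a with hsa | hsa
    · obtain ⟨d, rfl⟩ := exists_add_of_le hsa
      obtain ⟨y, z, hy, hz, rfl⟩ := ih rfl
      have hdb : d + b = r := add_left_cancel (by rw [← add_assoc, hab, h])
      exact ⟨y, _, hy, mul hdb z w hz, mul_mul _ _ _ _ _ _ _⟩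
    · obtain ⟨d, rfl⟩ := exists_add_of_le hsa
      have hdr : d + r = b := add_left_cancel (by rw [← add_assoc, hab, h])
      refine ⟨_, _, mul rfl x w hx, unit w r, ?_⟩
      rw [← w.mul_apply hdr, mul_mul rfl h hdr hab]

end IsUnitProduct

/-- The closed spans of the products of units form a subsystem. -/
noncomputable def unitProductSubsystem (E : ArvesonSystem.{u}) : Subsystem E where
  carrier t := (Submodule.span ℂ {x | IsUnitProduct E t x}).topologicalClosure
  isClosed _ := Submodule.isClosed_topologicalClosure _
  map_V s t := by
    refine le_antisymm (E.V_mem_of_tmul_mem (Submodule.isClosed_topologicalClosure _)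
      fun x hx y hy => ?_) ?_
    · refine HilbertTensor.mem_of_mem_closure (HilbertTensor.bilin (E.V s t)) _ _ _
        (Submodule.isClosed_topologicalClosure _) (fun x hx y hy => ?_) hx hy
      exact Submodule.le_topologicalClosure _ (Submodule.subset_span
        (IsUnitProduct.mul_mem rfl hx hy))
    · refine Submodule.topologicalClosure_minimal _ (Submodule.span_le.2 ?_)
        ((E.V s t).toHomeomorph.isClosedMap _ (HilbertTensor.isClosed_sub _ _))
      intro x hx
      obtain ⟨y, z, hy, hz, rfl⟩ := IsUnitProduct.exists_eq_mul hx rfl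
      exact ⟨_, HilbertTensor.tmul_mem_sub
        (Submodule.le_topologicalClosure _ (Submodule.subset_span hy))
        (Submodule.le_topologicalClosure _ (Submodule.subset_span hz)), rfl⟩

/-- Minimality of `E⁰`: the closed spans on the right form a subsystem containing all units. This
reduces statements about `E⁰` to finite products of units. -/
theorem unitSubsystem_le (E : ArvesonSystem.{u}) (t : ℝ≥0) :
    E.unitSubsystem.carrier t ≤
      (Submodule.span ℂ {x | IsUnitProduct E t x}).topologicalClosure := by
  intro x hx
  refine Subsystem.mem_sInf.1 hx E.unitProductSubsystem fun t => ?_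
  rintro _ ⟨w, rfl⟩
  exact Submodule.le_topologicalClosure _ (Submodule.subset_span (IsUnitProduct.unit w t))

theorem UnitSection.mem_unitSubsystem {E : ArvesonSystem.{u}} (w : E.UnitSection) (t : ℝ≥0) :
    w.toFun t ∈ E.unitSubsystem.carrier t :=
  Subsystem.mem_sInf.2 fun _ hS => hS t ⟨w, rfl⟩

theorem UnitSection.line_le_unitSubsystem {E : ArvesonSystem.{u}} (w : E.UnitSection) :
    Subsystem.line w ≤ E.unitSubsystem := fun t =>
  (Submodule.span_singleton_le_iff_mem _ _).2 (w.mem_unitSubsystem t)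

namespace Pairing

variable {E : ArvesonSystem.{u₁}} {F : ArvesonSystem.{u₂}} {G : ArvesonSystem.{u₃}}

/-- If a subsystem of `G` contains `w ⊗ F` and `E ⊗ v` for unital units `w`, `v`, then it contains
`E⁰ ⊗ F`. -/
theorem unitSubsystem_mem (m : Pairing E F G) (S : Subsystem G) {w : E.UnitSection}
    {v : F.UnitSection} (hw : w.IsUnital) (hv : v.IsUnital)
    (hS : ∀ t f, m.toFun t (w.toFun t) f ∈ S.carrier t)
    (hS' : ∀ t e, m.toFun t e (v.toFun t) ∈ S.carrier t) {t : ℝ≥0} {x : E.space t}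
    (hx : x ∈ E.unitSubsystem.carrier t) (f : F.space t) : m.toFun t x f ∈ S.carrier t := by
  have hprod : ∀ t x, IsUnitProduct E t x → ∀ f, m.toFun t x f ∈ S.carrier t := by
    intro t x hx
    induction hx with
    | unit w' t => exact m.unit_mem S hw hv hS hS' t
    | @mul s r t h x w' _ ih =>
      intro f
      have hcl : IsClosed ((S.carrier t).comap
          (m.toFun t (E.mul h x (w'.toFun r))).toLinearMap : Set (F.space t)) :=
        (S.isClosed t).preimage (m.toFun t (E.mul h x (w'.toFun r))).continuous
      -- Split `f` at the same time as the product of units; products `a b` are total, and each pair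
      -- of factors lands in `S`.
      have htop := eq_top_of_mul_mem h _ hcl fun a b => by
        change m.toFun t (E.mul h x (w'.toFun r)) (F.mul h a b) ∈ S.carrier t
        rw [m.mul_apply]
        exact S.mul_mem h (ih a) (m.unit_mem S hw hv hS hS' r b)
      have hf : f ∈ (S.carrier t).comap
          (m.toFun t (E.mul h x (w'.toFun r))).toLinearMap := htop ▸ Submodule.mem_top
      exact hf
  have hcl : IsClosed ((S.carrier t).comap ((m.toFun t).flip f).toLinearMap :
      Set (E.space t)) := (S.isClosed t).preimage ((m.toFun t).flip f).continuous
  exact Submodule.topologicalClosure_minimal _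
    (Submodule.span_le.2 fun x hx => hprod t x hx f) hcl (unitSubsystem_le E t hx)

/-- Elementary tensors, as a pairing of `E` and `F` with values in `E ⊗ F`. -/
noncomputable def tmul (E : ArvesonSystem.{u₁}) (F : ArvesonSystem.{u₂}) :
    Pairing E F (E.tensor F) where
  toFun t := HilbertTensor.mkL (E.space t) (F.space t)
  inner_apply _ _ _ _ _ := HilbertTensor.inner_tmul _ _ _ _
  V_apply _ _ _ _ _ _ := (HilbertTensor.exchange_tmul _ _ _ _ _ _).symm

/-- The pairing with the two arguments exchanged. -/
noncomputable def flip (m : Pairing E F G) : Pairing F E G where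
  toFun t := (m.toFun t).flip
  inner_apply t a b a' b' := (m.inner_apply t b a b' a').trans (mul_comm _ _)
  V_apply s t a b c d := m.V_apply s t b a d c

end Pairing

end ArvesonSystem

/-! ### The two inclusions. -/

theorem mainTheorem2 (E : ArvesonSystem.{u}) (F : ArvesonSystem.{v})
    (w : E.UnitSection) (hw : w.IsUnital) (w' : F.UnitSection) (hw' : w'.IsUnital) :
    ArvesonSystem.amalgamatedProduct E F = ArvesonSystem.spatialProduct w w' := by
  set S := ArvesonSystem.spatialProduct w w' with hSdef
  have hS : ∀ t f, (ArvesonSystem.Pairing.tmul E F).toFun t (w.toFun t) f ∈ S.carrier t :=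
    fun t f => (le_sup_left : _ ≤ S) t (HilbertTensor.tmul_mem_sub
      (Submodule.mem_span_singleton_self _)
      (by rw [ArvesonSystem.Subsystem.carrier_top]; trivial))
  have hS' : ∀ t e, (ArvesonSystem.Pairing.tmul E F).toFun t e (w'.toFun t) ∈ S.carrier t :=
    fun t e => (le_sup_right : _ ≤ S) t (HilbertTensor.tmul_mem_sub
      (by rw [ArvesonSystem.Subsystem.carrier_top]; trivial)
      (Submodule.mem_span_singleton_self _))
  refine le_antisymm (sup_le (fun t => ?_) fun t => ?_) (sup_le ?_ ?_)
  -- For `E ⊗ F⁰` the argument runs with the tensor factors, and hence the two units, exchanged.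
  · exact HilbertTensor.sub_le (S.isClosed t) fun x _ y hy =>
      (ArvesonSystem.Pairing.tmul E F).flip.unitSubsystem_mem S hw' hw hS' hS hy x
  · exact HilbertTensor.sub_le (S.isClosed t) fun x hx y _ =>
      (ArvesonSystem.Pairing.tmul E F).unitSubsystem_mem S hw hw' hS hS' hx y
  · exact le_sup_of_le_right fun t =>
      HilbertTensor.sub_mono (w.line_le_unitSubsystem t) le_rfl
  · exact le_sup_of_le_left fun t =>
      HilbertTensor.sub_mono le_rfl (w'.line_le_unitSubsystem t)
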